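/- Let $X,Y$ be input sets and let $f$ be a (possibly partial) function $X\times Y\to\{0,1\}$. All systems below are finite-dimensional. A $\mathsf{Q}\|^*$ protocol consists of a bipartite state $\rho$ shared by Alice and Bob, and of local quantum channels which Alice (on input $x\in X$) and Bob (on input $y\in Y$) apply to their shares to produce messages of $m_A$ and $m_B$ qubits. The referee adjoins ancilla qubits in the state $|0\rangle$ to the $m=m_A+m_B$ message qubits, applies a fixed unitary $U$ to all of these qubits, and measures one fixed qubit in the computational basis to obtain the output bit. An $\mathsf{R}\|^*$ protocol consists of a bipartite state shared by Alice and Bob, and of local measurements, chosen according to $x$ and $y$, whose outcomes are sent to the referee as classical messages of $c_A$ and $c_B$ bits. The referee outputs a bit that is a function of the two messages. Either protocol is a protocol for $f$ with success probability $p$ if on every input $(x,y)$ in the domain of $f$ it outputs $f(x,y)$ with probability at least $p$. A unitary on $N$ qubits has $T$-depth (at most) $d$ if it equals $C_{d+1}\bar T_d C_d\cdots \bar T_1C_1$, where each $C_i$ is a Clifford unitary on the $N$ qubits and each $\bar T_i$ applies $T=\mathrm{diag}(1,e^{i\pi/4})$ to some subset of the qubits. Theorem. There is an absolute constant $K$ such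 that the following holds for all $f$, $p$, $m$, $a$, $d$. Let there be given a $\mathsf{Q}\|^*$ protocol for $f$ with success probability $p$ that uses $m$ qubits of message in total, a shared state $\rho$, and a referee who uses at most $a$ ancilla qubits and applies a unitary of $T$-depth $d$. Then there is an $\mathsf{R}\|^*$ protocol for $f$ with success probability $p$ whose shared state consists of $\rho$ together with $k\le K\,(68(m+a))^d$ EPR pairs, and whose messages have total length $c_A+c_B\le K\,(68(m+a))^d$ bits. Moreover, on every input $(x,y)$ the output of the $\mathsf{R}\|^*$ protocol has exactly the same distribution as the output of the given $\mathsf{Q}\|^*$ protocol. -/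

import Mathlib

open scoped Matrix Kronecker ComplexOrder

noncomputable section

/-- Computational basis labels of a register whose qubits are indexed by `ι`. -/
abbrev Qubits (ι : Type) : Type := ι → Fin 2

/-- The tensor product of single-qubit operators. -/
def tensorGate {ι : Type} [Fintype ι] (G : ι → Matrix (Fin 2) (Fin 2) ℂ) :
    Matrix (Qubits ι) (Qubits ι) ℂ :=
  Matrix.of fun s t => ∏ q, G q (s q) (t q)

/-- The single-qubit Pauli matrices `I, X, Y, Z`. -/
def pauliMatrix : Fin 4 → Matrix (Fin 2) (Fin 2) ℂ :=
  ![!![1, 0; 0, 1], !![0, 1; 1, 0], !![0, -Complex.I; Complex.I, 0], !![1, 0; 0, -1]]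

/-- Membership in the Pauli group: a tensor product of Pauli matrices times a power of `i`. -/
def IsPauli {ι : Type} [Fintype ι] (P : Matrix (Qubits ι) (Qubits ι) ℂ) : Prop :=
  ∃ (k : ℕ) (σ : ι → Fin 4), P = Complex.I ^ k • tensorGate fun q => pauliMatrix (σ q)

/-- Clifford unitaries: those that conjugate the Pauli group into itself. -/
def IsClifford {ι : Type} [Fintype ι] [DecidableEq ι]
    (C : Matrix (Qubits ι) (Qubits ι) ℂ) : Prop :=
  C ∈ Matrix.unitaryGroup (Qubits ι) ℂ ∧ ∀ P, IsPauli P → IsPauli (Cᴴ * P * C)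

/-- The `T` gate `diag(1, e^{iπ/4})`. -/
def tGate : Matrix (Fin 2) (Fin 2) ℂ :=
  !![1, 0; 0, Complex.exp (Complex.I * (Real.pi / 4 : ℝ))]

/-- A layer of `T` gates, acting on the qubits in `S`. -/
def tLayer {ι : Type} [Fintype ι] [DecidableEq ι] (S : Finset ι) :
    Matrix (Qubits ι) (Qubits ι) ℂ :=
  tensorGate fun q => if q ∈ S then tGate else 1

/-- `HasTDepth d U`: the unitary `U` is implemented by a Clifford+T circuit
`C_{d+1} T_d C_d ⋯ T_1 C_1` with `d` layers of `T` gates. A layer may act on any set of qubits,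
possibly the empty one, so this says that the `T`-depth of `U` is at most `d`. -/
inductive HasTDepth {ι : Type} [Fintype ι] [DecidableEq ι] :
    ℕ → Matrix (Qubits ι) (Qubits ι) ℂ → Prop
  | clifford {C : Matrix (Qubits ι) (Qubits ι) ℂ} (hC : IsClifford C) : HasTDepth 0 C
  | layer {d : ℕ} {U C : Matrix (Qubits ι) (Qubits ι) ℂ} (hU : HasTDepth d U) (S : Finset ι)
      (hC : IsClifford C) : HasTDepth (d + 1) (C * tLayer S * U)

/-- Density matrices on a finite-dimensional system with basis `E`. -/
def IsDensityMatrix {E : Type} [Fintype E] (ρ : Matrix E E ℂ) : Prop :=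
  ρ.PosSemidef ∧ ρ.trace = 1

/-- Quantum channels (completely positive trace-preserving maps), given by Kraus operators. -/
structure QChannel (E F : Type) [Fintype E] [DecidableEq E] [Fintype F] where
  rank : ℕ
  kraus : Fin rank → Matrix F E ℂ
  complete : ∑ i, (kraus i)ᴴ * kraus i = 1

/-- The action of a product of two local channels on a bipartite state. -/
def localChannels {E₁ E₂ F₁ F₂ : Type} [Fintype E₁] [DecidableEq E₁] [Fintype F₁]
    [Fintype E₂] [DecidableEq E₂] [Fintype F₂] (Φ : QChannel E₁ F₁) (Ψ : QChannel E₂ F₂)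
    (ρ : Matrix (E₁ × E₂) (E₁ × E₂) ℂ) : Matrix (F₁ × F₂) (F₁ × F₂) ℂ :=
  ∑ i, ∑ j, (Φ.kraus i ⊗ₖ Ψ.kraus j) * ρ * (Φ.kraus i ⊗ₖ Ψ.kraus j)ᴴ

/-- Quantum measurements (POVMs) on a system with basis `E` and outcomes in `O`. -/
structure QMeasurement (E O : Type) [Fintype E] [DecidableEq E] [Fintype O] where
  effect : O → Matrix E E ℂ
  posSemidef : ∀ o, (effect o).PosSemidef
  complete : ∑ o, effect o = 1

/-- A `Q‖*` protocol (simultaneous quantum messages, shared entanglement) with input sets `X`, `Y`.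
Alice and Bob share `state` on systems `EA`, `EB`. Each applies a local channel, chosen according to
their own input, that produces a message of `mA` (resp. `mB`) qubits. The referee adds `a` ancilla
qubits in the state `|0⟩`, applies `unitary` and measures the qubit `outQubit`. -/
structure QuantumSMP (X Y EA EB : Type) [Fintype EA] [DecidableEq EA] [Fintype EB]
    [DecidableEq EB] (mA mB a : ℕ) where
  state : Matrix (EA × EB) (EA × EB) ℂ
  isDensityMatrix : IsDensityMatrix state
  alice : X → QChannel EA (Qubits (Fin mA))
  bob : Y → QChannel EB (Qubits (Fin mB))
  unitary : Matrix (Qubits (Fin mA ⊕ Fin mB ⊕ Fin a)) (Qubits (Fin mA ⊕ Fin mB ⊕ Fin a)) ℂ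
  isUnitary : unitary ∈ Matrix.unitaryGroup (Qubits (Fin mA ⊕ Fin mB ⊕ Fin a)) ℂ
  outQubit : Fin mA ⊕ Fin mB ⊕ Fin a

/-- The state `σ ⊗ |0⋯0⟩⟨0⋯0|` of the messages and the ancillas. -/
def withAncillas {mA mB : ℕ} (a : ℕ)
    (σ : Matrix (Qubits (Fin mA) × Qubits (Fin mB)) (Qubits (Fin mA) × Qubits (Fin mB)) ℂ) :
    Matrix (Qubits (Fin mA ⊕ Fin mB ⊕ Fin a)) (Qubits (Fin mA ⊕ Fin mB ⊕ Fin a)) ℂ :=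
  Matrix.of fun s t =>
    if (∀ i, s (.inr (.inr i)) = 0) ∧ (∀ i, t (.inr (.inr i)) = 0) then
      σ (fun i => s (.inl i), fun i => s (.inr (.inl i)))
        (fun i => t (.inl i), fun i => t (.inr (.inl i)))
    else 0

/-- The projector onto the outcome `b` of a computational-basis measurement of the qubit `q`. -/
def qubitProjector {ι : Type} [Fintype ι] [DecidableEq ι] (q : ι) (b : Fin 2) :
    Matrix (Qubits ι) (Qubits ι) ℂ :=
  Matrix.diagonal fun s => if s q = b then 1 else 0

/-- The probability that the referee outputs `b` on inputs `x`, `y`. -/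
def QuantumSMP.outProb {X Y EA EB : Type} [Fintype EA] [DecidableEq EA] [Fintype EB]
    [DecidableEq EB] {mA mB a : ℕ} (Q : QuantumSMP X Y EA EB mA mB a)
    (x : X) (y : Y) (b : Fin 2) : ℝ :=
  (Matrix.trace (qubitProjector Q.outQubit b *
    (Q.unitary * withAncillas a (localChannels (Q.alice x) (Q.bob y) Q.state) *
      Q.unitaryᴴ))).re

/-- An `R‖*` protocol (simultaneous classical messages, shared entanglement). Alice and Bob share
`state`. Each performs a local measurement, chosen according to their own input, whose outcome is sent
to the referee as a message of `cA` (resp. `cB`) bits. The referee outputs a function of the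
messages. -/
structure ClassicalSMP (X Y EA EB : Type) [Fintype EA] [DecidableEq EA] [Fintype EB]
    [DecidableEq EB] (cA cB : ℕ) where
  state : Matrix (EA × EB) (EA × EB) ℂ
  isDensityMatrix : IsDensityMatrix state
  alice : X → QMeasurement EA (Fin cA → Fin 2)
  bob : Y → QMeasurement EB (Fin cB → Fin 2)
  referee : (Fin cA → Fin 2) → (Fin cB → Fin 2) → Fin 2

/-- The probability that the referee outputs `b` on inputs `x`, `y`. -/
def ClassicalSMP.outProb {X Y EA EB : Type} [Fintype EA] [DecidableEq EA] [Fintype EB]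
    [DecidableEq EB] {cA cB : ℕ} (R : ClassicalSMP X Y EA EB cA cB)
    (x : X) (y : Y) (b : Fin 2) : ℝ :=
  ∑ u, ∑ v, if R.referee u v = b then
    (Matrix.trace (((R.alice x).effect u ⊗ₖ (R.bob y).effect v) * R.state)).re else 0

/-- A protocol with output probabilities `pr` computes the partial function `f` with success
probability `p`. The value `none` means that the input is outside the promise. -/
def ComputesWith {X Y : Type} (pr : X → Y → Fin 2 → ℝ) (f : X → Y → Option (Fin 2))
    (p : ℝ) : Prop :=
  ∀ x y b, f x y = some b → p ≤ pr x y b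

/-- `k` EPR pairs `(|00⟩ + |11⟩)/√2`, as a density matrix on Alice's and Bob's `k` qubits. -/
def eprPairs (k : ℕ) :
    Matrix (Qubits (Fin k) × Qubits (Fin k)) (Qubits (Fin k) × Qubits (Fin k)) ℂ :=
  Matrix.of fun s t => if s.1 = s.2 ∧ t.1 = t.2 then (1 / 2 : ℂ) ^ k else 0

/-- The tensor product of two shared states, with Alice's and Bob's parts grouped together. -/
def sharedTensor {EA EB FA FB : Type} (ρ : Matrix (EA × EB) (EA × EB) ℂ)
    (τ : Matrix (FA × FB) (FA × FB) ℂ) :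
    Matrix ((EA × FA) × (EB × FB)) ((EA × FA) × (EB × FB)) ℂ :=
  Matrix.of fun s t =>
    ρ (s.1.1, s.2.1) (t.1.1, t.2.1) * τ (s.1.2, s.2.2) (t.1.2, t.2.2)

end

/-! In the Heisenberg picture the output bit is governed by the observable O = U†ZU on messages and
ancillas. It suffices to write O, compressed to ancillas in |0⟩, as a signed sum of local effects
assisted by EPR pairs (`Implementable`); the parties' channels are absorbed into the effects at the
end.

Alice teleports her message to Bob, who runs the circuit on a state with a Pauli error known only to
Alice. Clifford layers map Pauli errors to Pauli errors. A T gate moved past an error with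
X-component f leaves an unwanted phase gate S^f, where f depends on the private data of both
parties. To remove it, Bob places the qubit in a register with positions `W × ZMod 2`. If f is
computed by permutations of positions, each known to one party (`Walk`), the qubit can be routed
from (w, 0) to (w, f): Bob's permutations are free, and Alice's are done by teleporting the register
to her and back. Bob undoes S at all positions with bit 1, and the inverse walk brings the qubit
back to (w, 0) (`CleanBit.exists_correction`).

The teleportations create new Pauli errors, but position and error together follow a walk with
equally many Alice steps (`Walk.exists_lift`), so the errors can again be tracked. With c qubits, a
layer multiplies the number of positions by 8 and the number of Alice steps by 4c+2; the cost is
thus exponential in the T-depth only. At the end the error merely changes the sign of a Pauli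
observable, and the referee computes this sign from the teleportation outcomes. Every step is an
identity of observables, so the output distribution is exact.

At depth 0 the bound is a constant, which excludes teleporting the message; there O is itself a
signed Pauli string and each party measures one factor. -/

noncomputable section

/-! ### Single-qubit Pauli operators, phase gate and T gate -/

/-- Labels of the single-qubit Pauli operators modulo phases: `(x, z)` stands for `X ^ x Z ^ z`. -/
abbrev PauliLabel : Type := ZMod 2 × ZMod 2

/-- The index of a Pauli label in the list `I, X, Y, Z`. -/
def pauliIndex (φ : PauliLabel) : Fin 4 :=
  if φ.1 = 0 then (if φ.2 = 0 then 0 else 3) else (if φ.2 = 0 then 1 else 2)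

/-- The Hermitian Pauli operator with a given label. -/
def pauliOp (φ : PauliLabel) : Matrix (Fin 2) (Fin 2) ℂ := pauliMatrix (pauliIndex φ)

/-- The commutation form of two Pauli labels. -/
def pauliComm (φ ψ : PauliLabel) : ZMod 2 := φ.1 * ψ.2 + φ.2 * ψ.1

/-- The sign character of `ZMod 2`. -/
def signChar (b : ZMod 2) : ℂ := if b = 0 then 1 else -1

/-- The phase gate `diag(1, i)`, the square of the `T` gate. -/
def phaseGate : Matrix (Fin 2) (Fin 2) ℂ := !![1, 0; 0, Complex.I]

/-- Conjugation of an operator. -/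
def conjBy {m n : Type} [Fintype n] (A : Matrix m n ℂ) (X : Matrix n n ℂ) : Matrix m m ℂ :=
  A * X * Aᴴ

/-- Equality of matrices up to a phase. -/
def PhaseEq {m n : Type} (A B : Matrix m n ℂ) : Prop := ∃ c : ℂ, c * star c = 1 ∧ A = c • B

lemma signChar_add (a b : ZMod 2) : signChar (a + b) = signChar a * signChar b := by
  have h : ∀ c : ZMod 2, c = 0 ∨ c = 1 := by decide
  rcases h a with rfl | rfl <;> rcases h b with rfl | rfl <;>
    simp [signChar, show (1 : ZMod 2) + 1 = 0 from rfl]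

lemma signChar_zero : signChar 0 = 1 := by simp [signChar]

lemma signChar_one : signChar 1 = -1 := by simp [signChar]

lemma signChar_injective : Function.Injective signChar := by
  intro a b
  have h : ∀ c : ZMod 2, c = 0 ∨ c = 1 := by decide
  have h1 : (1 : ℂ) ≠ -1 := by norm_num
  rcases h a with rfl | rfl <;> rcases h b with rfl | rfl <;> simp [signChar, h1, h1.symm]

lemma pauliIndex_surjective : Function.Surjective pauliIndex := by decide

lemma PauliLabel.cases {p : PauliLabel → Prop} (h0 : p (0, 0)) (h1 : p (1, 0)) (h2 : p (1, 1))
    (h3 : p (0, 1)) (φ : PauliLabel) : p φ := by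
  obtain ⟨x, z⟩ := φ
  fin_cases x <;> fin_cases z <;> assumption

lemma pauliOp_zero_zero : pauliOp (0, 0) = !![1, 0; 0, 1] := by
  simp [pauliOp, pauliIndex, pauliMatrix]

lemma pauliOp_one_zero : pauliOp (1, 0) = !![0, 1; 1, 0] := by
  simp [pauliOp, pauliIndex, pauliMatrix]

lemma pauliOp_one_one : pauliOp (1, 1) = !![0, -Complex.I; Complex.I, 0] := by
  simp [pauliOp, pauliIndex, pauliMatrix]

lemma pauliOp_zero_one : pauliOp (0, 1) = !![1, 0; 0, -1] := by
  simp [pauliOp, pauliIndex, pauliMatrix]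

lemma pauliOp_zero : pauliOp 0 = 1 := by
  rw [show (0 : PauliLabel) = (0, 0) from rfl, pauliOp_zero_zero, Matrix.one_fin_two]

lemma pauliOp_conjTranspose (φ : PauliLabel) : (pauliOp φ)ᴴ = pauliOp φ := by
  induction φ using PauliLabel.cases <;>
  simp only [pauliOp_zero_zero, pauliOp_one_zero, pauliOp_one_one, pauliOp_zero_one] <;>
  ext i j <;> fin_cases i <;> fin_cases j <;> simp

lemma pauliOp_mul_self (φ : PauliLabel) : pauliOp φ * pauliOp φ = 1 := by
  induction φ using PauliLabel.cases <;>
  simp only [pauliOp_zero_zero, pauliOp_one_zero, pauliOp_one_one, pauliOp_zero_one] <;>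
  ext i j <;> fin_cases i <;> fin_cases j <;> simp

lemma pauliOp_commute (φ ψ : PauliLabel) :
    pauliOp φ * pauliOp ψ = signChar (pauliComm φ ψ) • (pauliOp ψ * pauliOp φ) := by
  induction φ using PauliLabel.cases <;> induction ψ using PauliLabel.cases <;>
  simp only [pauliOp_zero_zero, pauliOp_one_zero, pauliOp_one_one, pauliOp_zero_one, pauliComm,
    mul_zero, mul_one, add_zero, zero_add, signChar, if_true, show (1 : ZMod 2) + 1 = 0 from rfl,
    one_ne_zero, if_false] <;>
  ext i j <;> fin_cases i <;> fin_cases j <;> simp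

lemma pauliOp_mul (φ ψ : PauliLabel) : PhaseEq (pauliOp φ * pauliOp ψ) (pauliOp (φ + ψ)) := by
  have key : ∃ c ∈ ({1, Complex.I, -Complex.I} : Set ℂ),
      pauliOp φ * pauliOp ψ = c • pauliOp (φ + ψ) := by
    simp only [Set.mem_insert_iff, Set.mem_singleton_iff, exists_eq_or_imp, exists_eq_left]
    induction φ using PauliLabel.cases <;> induction ψ using PauliLabel.cases <;>
    simp only [Prod.mk_add_mk, add_zero, zero_add, show (1 : ZMod 2) + 1 = 0 from rfl,
      pauliOp_zero_zero, pauliOp_one_zero, pauliOp_one_one, pauliOp_zero_one] <;>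
    simp
  obtain ⟨c, hc, h⟩ := key
  refine ⟨c, ?_, h⟩
  rcases hc with rfl | rfl | rfl <;> simp

/-- The Bell basis of two qubits is complete. -/
lemma sum_pauliOp (p q p' q' : Fin 2) :
    ∑ φ : PauliLabel, pauliOp φ p q * star (pauliOp φ p' q') =
      if p = p' ∧ q = q' then 2 else 0 := by
  have h : ∀ g : PauliLabel → ℂ, ∑ φ, g φ = g (0, 0) + g (0, 1) + (g (1, 0) + g (1, 1)) := by
    intro g
    rw [Fintype.sum_prod_type]
    exact (Fin.sum_univ_two _).trans (congrArg₂ _ (Fin.sum_univ_two _) (Fin.sum_univ_two _))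
  rw [h, pauliOp_zero_zero, pauliOp_one_zero, pauliOp_one_one, pauliOp_zero_one]
  fin_cases p <;> fin_cases q <;> fin_cases p' <;> fin_cases q' <;> norm_num

lemma phaseGate_unitary : phaseGateᴴ * phaseGate = 1 := by
  ext i j; fin_cases i <;> fin_cases j <;> simp [phaseGate, Matrix.mul_apply, Fin.sum_univ_two]

/-- The label of a Pauli operator conjugated by the phase gate. -/
def phaseShear (φ : PauliLabel) : PauliLabel := (φ.1, φ.2 + φ.1)

lemma pauliOp_mul_phaseGate (φ : PauliLabel) :
    PhaseEq (pauliOp φ * phaseGate) (phaseGate * pauliOp (phaseShear φ)) := by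
  have key : ∃ c ∈ ({1, -1} : Set ℂ),
      pauliOp φ * phaseGate = c • (phaseGate * pauliOp (phaseShear φ)) := by
    simp only [Set.mem_insert_iff, Set.mem_singleton_iff, exists_eq_or_imp, exists_eq_left]
    have hI : Complex.I * Complex.I = -1 := Complex.I_mul_I
    induction φ using PauliLabel.cases <;>
    simp only [phaseShear, add_zero, zero_add, show (1 : ZMod 2) + 1 = 0 from rfl,
      pauliOp_zero_zero, pauliOp_one_zero, pauliOp_one_one, pauliOp_zero_one, phaseGate] <;>
    simp
  obtain ⟨c, hc, h⟩ := key
  refine ⟨c, ?_, h⟩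
  rcases hc with rfl | rfl <;> simp

lemma tGate_unitary : tGateᴴ * tGate = 1 := by
  have h : (starRingEnd ℂ) (Complex.exp (Complex.I * (Real.pi / 4 : ℝ))) *
      Complex.exp (Complex.I * (Real.pi / 4 : ℝ)) = 1 := by
    rw [← Complex.exp_conj, ← Complex.exp_add, map_mul, Complex.conj_I, Complex.conj_ofReal]
    simp
  ext i j; fin_cases i <;> fin_cases j <;> simp [tGate, Matrix.mul_apply, Fin.sum_univ_two]
  simpa using h

/-- Since exp(iπ/4)² = i, T X T† is S X up to a phase, while Z commutes with T. So only the
X-component of an error matters, and the defect S is again Clifford. -/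
lemma tGate_mul_pauliOp (φ : PauliLabel) :
    PhaseEq (tGate * pauliOp φ)
      ((if φ.1 = 1 then phaseGate else 1) * pauliOp φ * tGate) := by
  set ω := Complex.exp (Complex.I * (Real.pi / 4 : ℝ)) with hω
  have h1 : star ω * ω = 1 := by
    rw [hω, Complex.star_def, ← Complex.exp_conj, ← Complex.exp_add, map_mul, Complex.conj_I,
      Complex.conj_ofReal]
    simp
  have h2 : ω * ω = Complex.I := by
    rw [hω, ← Complex.exp_add]
    refine (congrArg Complex.exp ?_).trans Complex.exp_pi_div_two_mul_I
    push_cast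
    ring
  have h3 : star ω * Complex.I = ω := by rw [← h2, ← mul_assoc, h1, one_mul]
  have ht : tGate = !![1, 0; 0, ω] := rfl
  induction φ using PauliLabel.cases
  · exact ⟨1, by simp, by simp [pauliOp_zero_zero, ht]⟩
  · refine ⟨star ω, by simpa using h1, ?_⟩
    rw [ht]
    simp only [pauliOp_one_zero, phaseGate, if_true]
    simp at h1 h3
    simp [h1, h3]
  · refine ⟨star ω, by simpa using h1, ?_⟩
    rw [ht]
    simp only [pauliOp_one_one, phaseGate, if_true]
    have h4 : Complex.I * ω = -star ω := by
      linear_combination -Complex.I * h3 + star ω * Complex.I_mul_I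
    simp at h1 h4
    simp
    refine ⟨?_, ?_⟩
    · linear_combination -Complex.I * h1
    · linear_combination h4
  · exact ⟨1, by simp, by simp [pauliOp_zero_one, ht]⟩

/-! ### Equality up to phase and conjugation -/

section Phase

variable {l m n : Type}

lemma PhaseEq.refl (A : Matrix m n ℂ) : PhaseEq A A := ⟨1, by simp, by simp⟩

lemma PhaseEq.symm {A B : Matrix m n ℂ} (h : PhaseEq A B) : PhaseEq B A := by
  obtain ⟨c, hc, rfl⟩ := h
  exact ⟨star c, by rw [star_star, mul_comm, hc], by rw [smul_smul, mul_comm, hc, one_smul]⟩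

lemma PhaseEq.trans {A B C : Matrix m n ℂ} (h : PhaseEq A B) (h' : PhaseEq B C) :
    PhaseEq A C := by
  obtain ⟨c, hc, rfl⟩ := h
  obtain ⟨c', hc', rfl⟩ := h'
  refine ⟨c * c', ?_, by rw [smul_smul]⟩
  rw [star_mul']
  linear_combination hc * c' * star c' + hc'

lemma PhaseEq.mul [Fintype m] {A B : Matrix l m ℂ} {C D : Matrix m n ℂ} (h : PhaseEq A B)
    (h' : PhaseEq C D) : PhaseEq (A * C) (B * D) := by
  obtain ⟨c, hc, rfl⟩ := h
  obtain ⟨c', hc', rfl⟩ := h'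
  refine ⟨c * c', ?_, by rw [Matrix.smul_mul, Matrix.mul_smul, smul_smul]⟩
  rw [star_mul']
  linear_combination hc * c' * star c' + hc'

lemma PhaseEq.conjBy_eq [Fintype n] {A B : Matrix m n ℂ} (h : PhaseEq A B) (X : Matrix n n ℂ) :
    conjBy A X = conjBy B X := by
  obtain ⟨c, hc, rfl⟩ := h
  simp only [conjBy, Matrix.conjTranspose_smul, Matrix.smul_mul, Matrix.mul_smul, smul_smul]
  rw [mul_comm, hc, one_smul]

lemma conjBy_mul [Fintype m] [Fintype n] (A : Matrix l m ℂ) (B : Matrix m n ℂ)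
    (X : Matrix n n ℂ) : conjBy (A * B) X = conjBy A (conjBy B X) := by
  simp only [conjBy, Matrix.conjTranspose_mul, Matrix.mul_assoc]

lemma conjBy_one [Fintype n] [DecidableEq n] (X : Matrix n n ℂ) : conjBy 1 X = X := by
  simp [conjBy]

lemma conjBy_apply [Fintype n] (A : Matrix m n ℂ) (X : Matrix n n ℂ) (i j : m) :
    conjBy A X i j = ∑ k, ∑ k', A i k * X k k' * star (A j k') := by
  simp only [conjBy, Matrix.mul_apply, Matrix.conjTranspose_apply, Finset.sum_mul]
  exact Finset.sum_comm

end Phase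

/-! ### Pauli strings, commutation signs and Clifford unitaries -/

section Tensor

variable {ι : Type} [Fintype ι]

lemma tensorGate_one :
    tensorGate (fun _ : ι => (1 : Matrix (Fin 2) (Fin 2) ℂ)) = 1 := by
  ext s t
  simp only [tensorGate, Matrix.of_apply, Matrix.one_apply, Finset.prod_ite_zero,
    Finset.prod_const_one, Finset.mem_univ, forall_const, funext_iff]

lemma tensorGate_conjTranspose (G : ι → Matrix (Fin 2) (Fin 2) ℂ) :
    (tensorGate G)ᴴ = tensorGate fun q => (G q)ᴴ := by
  ext s t
  simp [tensorGate, Matrix.conjTranspose_apply]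

lemma PhaseEq.tensorGate {G H : ι → Matrix (Fin 2) (Fin 2) ℂ} (h : ∀ q, PhaseEq (G q) (H q)) :
    PhaseEq (tensorGate G) (tensorGate H) := by
  choose c hc h using h
  refine ⟨∏ q, c q, ?_, ?_⟩
  · rw [star_prod, ← Finset.prod_mul_distrib]
    exact Finset.prod_eq_one fun q _ => hc q
  · ext s t
    simp [_root_.tensorGate, h, Finset.prod_mul_distrib]

/-- The tensor product of Pauli operators with given labels. -/
def pauliString (E : ι → PauliLabel) : Matrix (Qubits ι) (Qubits ι) ℂ :=
  tensorGate fun q => pauliOp (E q)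

/-- The commutation form of two strings of Pauli labels. -/
def stringComm (E τ : ι → PauliLabel) : ZMod 2 := ∑ q, pauliComm (E q) (τ q)

lemma tensorGate_smul (c : ι → ℂ) (G : ι → Matrix (Fin 2) (Fin 2) ℂ) :
    tensorGate (fun q => c q • G q) = (∏ q, c q) • tensorGate G := by
  ext s t
  simp [tensorGate, Finset.prod_mul_distrib]

lemma stringComm_add_left (E E' τ : ι → PauliLabel) :
    stringComm (E + E') τ = stringComm E τ + stringComm E' τ := by
  simp only [stringComm, ← Finset.sum_add_distrib]
  refine Finset.sum_congr rfl fun q _ => ?_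
  simp only [pauliComm, Pi.add_apply, Prod.fst_add, Prod.snd_add]
  ring

lemma isPauli_iff {P : Matrix (Qubits ι) (Qubits ι) ℂ} :
    IsPauli P ↔ ∃ (k : ℕ) (E : ι → PauliLabel), P = Complex.I ^ k • pauliString E := by
  constructor
  · rintro ⟨k, σ, rfl⟩
    choose g hg using pauliIndex_surjective
    exact ⟨k, fun q => g (σ q), by simp only [pauliString, pauliOp, hg]⟩
  · rintro ⟨k, E, rfl⟩
    exact ⟨k, fun q => pauliIndex (E q), rfl⟩

lemma pauliString_conjTranspose (E : ι → PauliLabel) : (pauliString E)ᴴ = pauliString E := by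
  simp only [pauliString, tensorGate_conjTranspose, pauliOp_conjTranspose]

lemma pauliString_zero : pauliString (0 : ι → PauliLabel) = 1 := by
  simp only [pauliString, Pi.zero_apply, pauliOp_zero, tensorGate_one]

variable [DecidableEq ι]

lemma tensorGate_mul (G H : ι → Matrix (Fin 2) (Fin 2) ℂ) :
    tensorGate G * tensorGate H = tensorGate fun q => G q * H q := by
  ext s t
  simp only [tensorGate, Matrix.mul_apply, Matrix.of_apply, ← Finset.prod_mul_distrib]
  exact (Fintype.prod_sum fun q k => G q (s q) k * H q k (t q)).symm

lemma tensorGate_unitary {G : ι → Matrix (Fin 2) (Fin 2) ℂ}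
    (h : ∀ q, (G q)ᴴ * G q = 1) : (tensorGate G)ᴴ * tensorGate G = 1 := by
  rw [tensorGate_conjTranspose, tensorGate_mul]
  simp only [h, tensorGate_one]

lemma signChar_sum {α : Type} (s : Finset α) (f : α → ZMod 2) :
    signChar (∑ q ∈ s, f q) = ∏ q ∈ s, signChar (f q) := by
  classical
  induction s using Finset.induction_on with
  | empty => simp [signChar_zero]
  | insert a s ha ih => rw [Finset.sum_insert ha, Finset.prod_insert ha, signChar_add, ih]

lemma pauliString_commute (E τ : ι → PauliLabel) :
    pauliString E * pauliString τ =
      signChar (stringComm E τ) • (pauliString τ * pauliString E) := by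
  simp only [pauliString, tensorGate_mul, stringComm, signChar_sum, ← tensorGate_smul,
    ← pauliOp_commute]

lemma pauliString_mul_self (E : ι → PauliLabel) :
    pauliString E * pauliString E = 1 := by
  simp only [pauliString, tensorGate_mul, pauliOp_mul_self, tensorGate_one]

lemma sum_pauliString (p q p' q' : Qubits ι) :
    ∑ E : ι → PauliLabel, pauliString E p q * star (pauliString E p' q') =
      if p = p' ∧ q = q' then 2 ^ Fintype.card ι else 0 := by
  simp only [pauliString, tensorGate, Matrix.of_apply, star_prod, ← Finset.prod_mul_distrib]
  rw [← Fintype.prod_sum fun i φ => pauliOp φ (p i) (q i) * star (pauliOp φ (p' i) (q' i))]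
  simp only [sum_pauliOp, Finset.prod_ite_zero, Finset.prod_const, Finset.card_univ,
    Finset.mem_univ, forall_const, funext_iff, forall_and]

lemma stringComm_single_left (r : ι) (φ : PauliLabel) (τ : ι → PauliLabel) :
    stringComm (Pi.single r φ) τ = pauliComm φ (τ r) := by
  rw [stringComm, Finset.sum_eq_single r]
  · simp
  · intro q _ hq
    simp [Pi.single_eq_of_ne hq, pauliComm]
  · simp

lemma stringComm_single_right (r : ι) (φ : PauliLabel) (E : ι → PauliLabel) :
    stringComm E (Pi.single r φ) = pauliComm (E r) φ := by
  rw [stringComm, Finset.sum_eq_single r]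
  · simp
  · intro q _ hq
    simp [Pi.single_eq_of_ne hq, pauliComm]
  · simp

lemma smul_pauliString_injective (E : ι → PauliLabel) :
    Function.Injective fun c : ℂ => c • pauliString E := by
  intro c d h
  have h1 := congrArg (· * pauliString E) h
  simp only [Matrix.smul_mul, pauliString_mul_self] at h1
  simpa using congrFun (congrFun h1 0) 0

lemma stringComm_eq_of_commute {E τ : ι → PauliLabel} {c : ℂ}
    (h : pauliString E * pauliString τ = c • (pauliString τ * pauliString E)) :
    signChar (stringComm E τ) = c := by
  rw [pauliString_commute] at h
  have h1 := congrArg (· * (pauliString E * pauliString τ)) h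
  simp only [Matrix.smul_mul] at h1
  rw [show pauliString τ * pauliString E * (pauliString E * pauliString τ) = 1 by
    rw [Matrix.mul_assoc, ← Matrix.mul_assoc (pauliString E), pauliString_mul_self,
      Matrix.one_mul, pauliString_mul_self]] at h1
  simpa using congrFun (congrFun h1 0) 0

/-- Commutation signs are invariant under conjugation and blind to phases. -/
lemma stringComm_congr_phase {E τ E' τ' : ι → PauliLabel}
    {U V : Matrix (Qubits ι) (Qubits ι) ℂ} (hUV : U * V = 1)
    (h : PhaseEq (V * pauliString E' * U) (pauliString E))
    (h' : PhaseEq (V * pauliString τ' * U) (pauliString τ)) :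
    stringComm E' τ' = stringComm E τ := by
  have key : ∀ A B : Matrix (Qubits ι) (Qubits ι) ℂ, V * A * U * (V * B * U) = V * (A * B) * U := by
    intro A B
    calc V * A * U * (V * B * U) = V * A * (U * V) * B * U := by simp only [Matrix.mul_assoc]
      _ = _ := by rw [hUV, Matrix.mul_one]; simp only [Matrix.mul_assoc]
  obtain ⟨c, hc, h⟩ := h.symm
  obtain ⟨c', hc', h'⟩ := h'.symm
  refine (signChar_injective (stringComm_eq_of_commute ?_)).symm
  rw [h, h']
  simp only [Matrix.smul_mul, Matrix.mul_smul, key, pauliString_commute E' τ', smul_smul]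
  congr 1
  ring

/-- The commutation signs with single-qubit strings determine every label, and they ignore phases.
-/
lemma eq_of_phaseEq_pauliString {E τ : ι → PauliLabel}
    (h : PhaseEq (pauliString E) (pauliString τ)) : E = τ := by
  funext q
  have h1 : ∀ φ, pauliComm (E q) φ = pauliComm (τ q) φ := by
    intro φ
    rw [← stringComm_single_right, ← stringComm_single_right]
    refine stringComm_congr_phase (U := 1) (V := 1) (Matrix.mul_one _) ?_ ?_
    · simpa using h
    · simpa using PhaseEq.refl _
  revert h1
  generalize E q = a
  generalize τ q = b
  revert a b
  decide

variable {C : Matrix (Qubits ι) (Qubits ι) ℂ}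

lemma IsClifford.conjTranspose_mul (hC : IsClifford C) : Cᴴ * C = 1 :=
  Matrix.mem_unitaryGroup_iff'.1 hC.1

lemma IsClifford.mul_conjTranspose (hC : IsClifford C) : C * Cᴴ = 1 :=
  Matrix.mem_unitaryGroup_iff.1 hC.1

lemma IsClifford.exists_pullback (hC : IsClifford C) (τ : ι → PauliLabel) :
    ∃ τ', PhaseEq (Cᴴ * pauliString τ * C) (pauliString τ') := by
  obtain ⟨k, E, h⟩ := isPauli_iff.1 (hC.2 (pauliString τ) (isPauli_iff.2 ⟨0, τ, by simp⟩))
  refine ⟨E, Complex.I ^ k, ?_, h⟩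
  rw [star_pow, ← mul_pow]
  simp

/-- `IsClifford` only controls P ↦ C†PC. The induced map on the finite set of label strings is
injective, hence surjective, which gives the other direction. -/
lemma IsClifford.exists_pushforward (hC : IsClifford C) :
    ∃ g : (ι → PauliLabel) → ι → PauliLabel, (∀ E, PhaseEq (Cᴴ * pauliString (g E) * C)
      (pauliString E)) := by
  choose g hg using hC.exists_pullback
  have hinj : Function.Injective g := by
    intro τ τ' h
    have h1 := (hg τ).trans (h ▸ (hg τ').symm)
    refine eq_of_phaseEq_pauliString ?_
    have h2 := ((PhaseEq.refl C).mul h1).mul (PhaseEq.refl Cᴴ)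
    have h3 : ∀ A, C * (Cᴴ * A * C) * Cᴴ = A := by
      intro A
      calc C * (Cᴴ * A * C) * Cᴴ = (C * Cᴴ) * A * (C * Cᴴ) := by simp only [Matrix.mul_assoc]
        _ = A := by rw [hC.mul_conjTranspose, Matrix.one_mul, Matrix.mul_one]
    rwa [h3, h3] at h2
  choose f hf using Finite.surjective_of_injective hinj
  exact ⟨f, fun E => by simpa only [hf] using hg (f E)⟩

/-- A Hermitian Pauli-group element conjugated by a Clifford unitary is a signed Pauli string. -/
lemma IsClifford.exists_sign (hC : IsClifford C) (τ : ι → PauliLabel) :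
    ∃ (b : ZMod 2) (τ' : ι → PauliLabel),
      Cᴴ * pauliString τ * C = signChar b • pauliString τ' := by
  obtain ⟨τ', c, hc, h⟩ := hC.exists_pullback τ
  have h1 : (Cᴴ * pauliString τ * C)ᴴ = Cᴴ * pauliString τ * C := by
    simp only [Matrix.conjTranspose_mul, Matrix.conjTranspose_conjTranspose,
      pauliString_conjTranspose, Matrix.mul_assoc]
  rw [h, Matrix.conjTranspose_smul, pauliString_conjTranspose] at h1
  -- Hermiticity forces the phase to be real, hence ±1.
  have h2 : star c = c := smul_pauliString_injective τ' h1
  rw [h2] at hc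
  rcases mul_self_eq_one_iff.1 hc with h3 | h3
  · exact ⟨0, τ', by rw [h, h3]; simp [signChar]⟩
  · exact ⟨1, τ', by rw [h, h3]; simp [signChar]⟩

lemma qubitProjector_eq (q : ι) (b : Fin 2) :
    qubitProjector q b =
      (1 / 2 : ℂ) • (1 + signChar (b : ZMod 2) • pauliString (Pi.single q (0, 1))) := by
  have hdiag : pauliString (Pi.single q (0, 1)) =
      Matrix.diagonal fun s : Qubits ι => if s q = 0 then (1 : ℂ) else -1 := by
    ext s t
    simp only [pauliString, tensorGate, Matrix.of_apply, Matrix.diagonal_apply]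
    rw [Fintype.prod_eq_mul_prod_compl q]
    have h1 : ∀ i ∈ ({q}ᶜ : Finset ι),
        pauliOp ((Pi.single q (0, 1) : ι → PauliLabel) i) (s i) (t i) =
          if s i = t i then 1 else 0 := by
      intro i hi
      rw [Pi.single_eq_of_ne (by simpa using hi), pauliOp_zero, Matrix.one_apply]
    rw [Finset.prod_congr rfl h1, Finset.prod_ite_zero, Pi.single_eq_same, pauliOp_zero_one]
    have h2 : (s = t) ↔ s q = t q ∧ ∀ i ∈ ({q}ᶜ : Finset ι), s i = t i := by
      constructor
      · rintro rfl; simp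
      · rintro ⟨h, h'⟩
        funext i
        by_cases hi : i = q
        · rw [hi, h]
        · exact h' i (by simpa using hi)
    simp only [h2]
    generalize s q = a
    generalize t q = b
    by_cases h3 : ∀ i ∈ ({q}ᶜ : Finset ι), s i = t i
    · simp only [if_pos h3, and_iff_left h3]
      fin_cases a <;> fin_cases b <;> simp
    · simp only [mul_zero, h3, and_false, if_false]
  rw [hdiag, qubitProjector, ← Matrix.diagonal_one, ← Matrix.diagonal_smul,
    Matrix.diagonal_add, ← Matrix.diagonal_smul]
  congr 1
  funext s
  simp only [Pi.smul_apply, smul_eq_mul]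
  generalize s q = a
  have h : ∀ c : Fin 2, c = 0 ∨ c = 1 := by decide
  have h0 : signChar (0 : Fin 2) = 1 := signChar_zero
  have h1 : signChar (1 : Fin 2) = -1 := signChar_one
  rcases h a with rfl | rfl <;> rcases h b with rfl | rfl <;> norm_num [h0, h1]

end Tensor

/-! ### Operators assisted by a maximally entangled state -/

section Contract

variable {A B A' B' D : Type} [Fintype D]

/-- The operator on `A × B` implemented by operators on `A × D` and `B × D` when the two copies
of `D` are in the maximally entangled state. -/
def contract (M : Matrix (A × D) (A × D) ℂ) (N : Matrix (B × D) (B × D) ℂ) :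
    Matrix (A × B) (A × B) ℂ :=
  Matrix.of fun p p' => (Fintype.card D : ℂ)⁻¹ *
    ∑ d, ∑ d', M (p.1, d) (p'.1, d') * N (p.2, d) (p'.2, d')

lemma contract_sum_left {α : Type} (s : Finset α) (M : α → Matrix (A × D) (A × D) ℂ)
    (N : Matrix (B × D) (B × D) ℂ) :
    contract (∑ u ∈ s, M u) N = ∑ u ∈ s, contract (M u) N := by
  ext p p'
  simp only [contract, Matrix.of_apply, Matrix.sum_apply, Finset.sum_mul, ← Finset.mul_sum]
  congr 1
  symm
  rw [Finset.sum_comm]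
  refine Finset.sum_congr rfl fun d _ => ?_
  rw [Finset.sum_comm]

lemma contract_swap (M : Matrix (A × D) (A × D) ℂ) (N : Matrix (B × D) (B × D) ℂ) :
    contract N M = (contract M N).submatrix Prod.swap Prod.swap := by
  ext p p'
  simp only [contract, Matrix.of_apply, Matrix.submatrix_apply, Prod.fst_swap, Prod.snd_swap,
    mul_comm]

lemma contract_sum_right {α : Type} (s : Finset α) (M : Matrix (A × D) (A × D) ℂ)
    (N : α → Matrix (B × D) (B × D) ℂ) :
    contract M (∑ u ∈ s, N u) = ∑ u ∈ s, contract M (N u) := by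
  rw [contract_swap, contract_sum_left]
  ext p p'
  simp only [contract_swap M, Matrix.submatrix_apply, Matrix.sum_apply, Prod.swap_swap]

lemma conj_kronecker_one_apply [DecidableEq D] [Fintype A'] (K : Matrix A' A ℂ)
    (M : Matrix (A' × D) (A' × D) ℂ) (a a' : A) (d d' : D) :
    ((K ⊗ₖ (1 : Matrix D D ℂ))ᴴ * M * (K ⊗ₖ (1 : Matrix D D ℂ))) (a, d) (a', d') =
      ∑ c, ∑ c', star (K c a) * M (c, d) (c', d') * K c' a' := by
  simp only [Matrix.mul_apply, Matrix.conjTranspose_apply, Matrix.kroneckerMap_apply,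
    Fintype.sum_prod_type, Matrix.one_apply, Finset.sum_mul, mul_ite, ite_mul, mul_one,
    mul_zero, zero_mul, apply_ite star, star_zero, Finset.sum_ite_eq', Finset.mem_univ,
    if_true]
  rw [Finset.sum_comm]

lemma conj_kronecker_apply [Fintype A'] [Fintype B'] (K : Matrix A' A ℂ) (L : Matrix B' B ℂ)
    (X : Matrix (A' × B') (A' × B') ℂ) (a a' : A) (b b' : B) :
    ((K ⊗ₖ L)ᴴ * X * (K ⊗ₖ L)) (a, b) (a', b') =
      ∑ c', ∑ e', ∑ c, ∑ e,
        star (K c a * L e b) * X (c, e) (c', e') * (K c' a' * L e' b') := by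
  simp only [Matrix.mul_apply, Matrix.conjTranspose_apply, Matrix.kroneckerMap_apply,
    Fintype.sum_prod_type, Finset.sum_mul]

/-- `K` and `L` act trivially on the entangled systems, so local Kraus operators can be absorbed
into the local effects. The proof reorders a sixfold sum. -/
lemma contract_conj [DecidableEq D] [Fintype A'] [Fintype B'] (K : Matrix A' A ℂ)
    (L : Matrix B' B ℂ) (M : Matrix (A' × D) (A' × D) ℂ) (N : Matrix (B' × D) (B' × D) ℂ) :
    contract ((K ⊗ₖ (1 : Matrix D D ℂ))ᴴ * M * (K ⊗ₖ (1 : Matrix D D ℂ)))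
        ((L ⊗ₖ (1 : Matrix D D ℂ))ᴴ * N * (L ⊗ₖ (1 : Matrix D D ℂ))) =
      (K ⊗ₖ L)ᴴ * contract M N * (K ⊗ₖ L) := by
  ext ⟨a, b⟩ ⟨a', b'⟩
  rw [conj_kronecker_apply]
  simp only [contract, Matrix.of_apply, conj_kronecker_one_apply]
  let F : D × D × B' × B' × A' × A' → ℂ := fun x =>
    star (K x.2.2.2.2.1 a * L x.2.2.1 b) * ((Fintype.card D : ℂ)⁻¹ *
      (M (x.2.2.2.2.1, x.1) (x.2.2.2.2.2, x.2.1) * N (x.2.2.1, x.1) (x.2.2.2.1, x.2.1))) *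
      (K x.2.2.2.2.2 a' * L x.2.2.2.1 b')
  let σ : A' × B' × A' × B' × D × D ≃ D × D × B' × B' × A' × A' :=
    { toFun := fun y => (y.2.2.2.2.1, y.2.2.2.2.2, y.2.2.2.1, y.2.1, y.2.2.1, y.1)
      invFun := fun x => (x.2.2.2.2.2, x.2.2.2.1, x.2.2.2.2.1, x.2.2.1, x.1, x.2.1)
      left_inv := fun _ => rfl
      right_inv := fun _ => rfl }
  trans ∑ x, F x
  · simp only [Fintype.sum_prod_type, F, Finset.mul_sum, Finset.sum_mul, star_mul']
    iterate 6 refine Finset.sum_congr rfl fun _ _ => ?_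
    ring
  · rw [← Equiv.sum_comp σ]
    simp only [Fintype.sum_prod_type, F, σ, Equiv.coe_fn_mk, Finset.mul_sum, Finset.sum_mul]

end Contract

/-! ### Implementable observables: local operations and teleportation -/

/-- The effects of a measurement. -/
def IsPOVM {E U : Type} [DecidableEq E] [Fintype U] (M : U → Matrix E E ℂ) : Prop :=
  (∀ u, (M u).PosSemidef) ∧ ∑ u, M u = 1

/-- The family of observables `O i j`, where `i` is known to Alice and `j` to Bob, is measured by
local measurements with the help of `k` EPR pairs and of messages of `cA` and `cB` bits to a
referee, who outputs a sign. -/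
def Implementable {I J A B : Type} [DecidableEq A] [DecidableEq B] (k cA cB : ℕ)
    (O : I → J → Matrix (A × B) (A × B) ℂ) : Prop :=
  ∃ (D U V : Type) (_ : Fintype D) (_ : DecidableEq D) (_ : Fintype U) (_ : Fintype V)
    (M : I → U → Matrix (A × D) (A × D) ℂ) (N : J → V → Matrix (B × D) (B × D) ℂ)
    (r : I → U → J → V → ZMod 2),
    (∃ k₀ ≤ k, Fintype.card D = 2 ^ k₀) ∧ Fintype.card U ≤ 2 ^ cA ∧ Fintype.card V ≤ 2 ^ cB ∧
    (∀ i, IsPOVM (M i)) ∧ (∀ j, IsPOVM (N j)) ∧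
    ∀ i j, O i j = ∑ u, ∑ v, signChar (r i u j v) • contract (M i u) (N j v)

section Rules

variable {I J A B A' B' : Type} [DecidableEq A] [DecidableEq B] [DecidableEq A'] [DecidableEq B']
  {k cA cB k' cA' cB' : ℕ}

lemma Implementable.mono {O : I → J → Matrix (A × B) (A × B) ℂ} (h : Implementable k cA cB O)
    (hk : k ≤ k') (hA : cA ≤ cA') (hB : cB ≤ cB') : Implementable k' cA' cB' O := by
  obtain ⟨D, U, V, _, _, _, _, M, N, r, ⟨k₀, h₀, hD⟩, hU, hV, h⟩ := h
  exact ⟨D, U, V, _, _, _, _, M, N, r, ⟨k₀, h₀.trans hk, hD⟩,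
    hU.trans (Nat.pow_le_pow_right two_pos hA), hV.trans (Nat.pow_le_pow_right two_pos hB), h⟩

lemma IsPOVM.submatrix {E F U : Type} [DecidableEq E] [DecidableEq F] [Fintype U]
    {M : U → Matrix E E ℂ} (h : IsPOVM M) {f : F → E} (hf : Function.Injective f) :
    IsPOVM fun u => (M u).submatrix f f := by
  refine ⟨fun u => (h.1 u).submatrix f, ?_⟩
  rw [← Matrix.submatrix_one f hf, ← h.2]
  ext p p'
  simp only [Matrix.sum_apply, Matrix.submatrix_apply]

lemma Implementable.submatrix {O : I → J → Matrix (A' × B') (A' × B') ℂ}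
    (h : Implementable k cA cB O) (f : I → A → A') (g : J → B → B')
    (hf : ∀ i, Function.Injective (f i)) (hg : ∀ j, Function.Injective (g j)) :
    Implementable k cA cB fun i j =>
      (O i j).submatrix (Prod.map (f i) (g j)) (Prod.map (f i) (g j)) := by
  obtain ⟨D, U, V, _, _, _, _, M, N, r, hD, hU, hV, hM, hN, h⟩ := h
  refine ⟨D, U, V, _, _, _, _, fun i u => (M i u).submatrix (Prod.map (f i) id)
    (Prod.map (f i) id), fun j v => (N j v).submatrix (Prod.map (g j) id) (Prod.map (g j) id),
    r, hD, hU, hV, fun i => (hM i).submatrix ((hf i).prodMap Function.injective_id),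
    fun j => (hN j).submatrix ((hg j).prodMap Function.injective_id), fun i j => ?_⟩
  ext p p'
  simp only [h, Matrix.submatrix_apply, Matrix.sum_apply, Matrix.smul_apply]
  rfl

lemma Implementable.swap {O : I → J → Matrix (A × B) (A × B) ℂ} (h : Implementable k cA cB O) :
    Implementable k cB cA fun j i => (O i j).submatrix Prod.swap Prod.swap := by
  obtain ⟨D, U, V, _, _, _, _, M, N, r, hD, hU, hV, hM, hN, h⟩ := h
  refine ⟨D, V, U, _, _, _, _, N, M, fun j v i u => r i u j v, hD, hV, hU, hN, hM,
    fun j i => ?_⟩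
  ext p p'
  simp only [h, contract_swap (M _ _), Matrix.submatrix_apply, Matrix.sum_apply,
    Matrix.smul_apply]
  exact Finset.sum_comm

lemma IsPOVM.kraus {E F U H : Type} [Fintype E] [DecidableEq E] [Fintype F] [DecidableEq F]
    [Fintype U] [Fintype H] {M : U → Matrix E E ℂ} (h : IsPOVM M) {K : H → Matrix E F ℂ}
    (hK : ∑ x, (K x)ᴴ * K x = 1) : IsPOVM fun u => ∑ x, (K x)ᴴ * M u * K x := by
  refine ⟨fun u => Matrix.posSemidef_sum _ fun x _ => (h.1 u).conjTranspose_mul_mul_same _, ?_⟩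
  rw [Finset.sum_comm, ← hK]
  refine Finset.sum_congr rfl fun x _ => ?_
  rw [← Matrix.sum_mul, ← Matrix.mul_sum, h.2, Matrix.mul_one]

lemma sum_kronecker_one {E F D H : Type} [Fintype E] [DecidableEq F] [Fintype D] [DecidableEq D]
    [Fintype H] {K : H → Matrix E F ℂ} (hK : ∑ x, (K x)ᴴ * K x = 1) :
    ∑ x, (K x ⊗ₖ (1 : Matrix D D ℂ))ᴴ * (K x ⊗ₖ (1 : Matrix D D ℂ)) = 1 := by
  simp only [Matrix.conjTranspose_kronecker, ← Matrix.mul_kronecker_mul,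
    Matrix.conjTranspose_one, Matrix.mul_one]
  rw [← Matrix.one_kronecker_one, ← hK]
  ext p p'
  simp only [Matrix.sum_apply, Matrix.kroneckerMap_apply, Finset.sum_mul]

/-- Bob applies a channel, in the Heisenberg picture. -/
lemma Implementable.kraus_right [Fintype A] [Fintype B] [Fintype B'] {H : Type} [Fintype H]
    {O : I → J → Matrix (A × B') (A × B') ℂ} (h : Implementable k cA cB O)
    (K : J → H → Matrix B' B ℂ) (hK : ∀ j, ∑ x, (K j x)ᴴ * K j x = 1) :
    Implementable k cA cB fun i j => ∑ x, ((1 : Matrix A A ℂ) ⊗ₖ K j x)ᴴ * O i j *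
      ((1 : Matrix A A ℂ) ⊗ₖ K j x) := by
  obtain ⟨D, U, V, _, _, _, _, M, N, r, hD, hU, hV, hM, hN, h⟩ := h
  refine ⟨D, U, V, _, _, _, _, M, fun j v => ∑ x, (K j x ⊗ₖ (1 : Matrix D D ℂ))ᴴ * N j v *
    (K j x ⊗ₖ (1 : Matrix D D ℂ)), r, hD, hU, hV, hM,
    fun j => (hN j).kraus (sum_kronecker_one (hK j)), fun i j => ?_⟩
  have h1 : ∀ x u v, ((1 : Matrix A A ℂ) ⊗ₖ K j x)ᴴ * contract (M i u) (N j v) *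
      ((1 : Matrix A A ℂ) ⊗ₖ K j x) = contract (M i u) ((K j x ⊗ₖ (1 : Matrix D D ℂ))ᴴ * N j v *
    (K j x ⊗ₖ (1 : Matrix D D ℂ))) := by
    intro x u v
    rw [← contract_conj]
    simp
  simp only [h, Matrix.mul_sum, Matrix.sum_mul, Matrix.mul_smul, Matrix.smul_mul, h1,
    contract_sum_right, Finset.smul_sum]
  rw [Finset.sum_comm]
  exact Finset.sum_congr rfl fun u _ => Finset.sum_comm

/-- Local measurements without entanglement. -/
lemma Implementable.of_measurements {U V : Type} [Fintype U] [Fintype V]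
    (hU : Fintype.card U ≤ 2 ^ cA) (hV : Fintype.card V ≤ 2 ^ cB)
    {M : I → U → Matrix A A ℂ} {N : J → V → Matrix B B ℂ} (hM : ∀ i, IsPOVM (M i))
    (hN : ∀ j, IsPOVM (N j)) (r : I → U → J → V → ZMod 2) :
    Implementable 0 cA cB fun i j => ∑ u, ∑ v, signChar (r i u j v) • (M i u ⊗ₖ N j v) := by
  refine ⟨Unit, U, V, inferInstance, inferInstance, _, _,
    fun i u => (M i u).submatrix Prod.fst Prod.fst,
    fun j v => (N j v).submatrix Prod.fst Prod.fst, r, ⟨0, le_rfl, by simp⟩, hU, hV,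
    fun i => (hM i).submatrix (fun _ _ h => Prod.ext h rfl),
    fun j => (hN j).submatrix (fun _ _ h => Prod.ext h rfl), fun i j => ?_⟩
  refine Finset.sum_congr rfl fun u _ => Finset.sum_congr rfl fun v _ => ?_
  ext p p'
  simp [contract]

/-- Bob teleports a register to Alice; the outcome `t` is known to Bob. -/
lemma Implementable.teleport [Fintype B] {κ : Type} [Fintype κ] [DecidableEq κ]
    {O' : I → J × (κ → PauliLabel) → Matrix ((A × Qubits κ) × B) ((A × Qubits κ) × B) ℂ}
    (h : Implementable k cA cB O')
    {O : I → J → Matrix (A × (B × Qubits κ)) (A × (B × Qubits κ)) ℂ}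
    (hO : ∀ i j t a b p a' b' p', O i j (a, b, p) (a', b', p') =
      ∑ q, ∑ q', pauliString t p q * O' i (j, t) ((a, q), b) ((a', q'), b') *
        star (pauliString t p' q')) :
    Implementable (k + Fintype.card κ) cA (2 * Fintype.card κ + cB) O := by
  obtain ⟨D, U, V, _, _, _, _, M, N, r, ⟨k₀, hk₀, hD⟩, hU, hV, hM, hN, h⟩ := h
  set n := Fintype.card κ with hn
  have h2 : ((2 : ℂ) ^ n) ≠ 0 := by positivity
  let e : A × (D × Qubits κ) → (A × Qubits κ) × D := fun x => ((x.1, x.2.2), x.2.1)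
  let g : (B × Qubits κ) × (D × Qubits κ) → (B × D) × (Qubits κ × Qubits κ) :=
    fun x => ((x.1.1, x.2.1), (x.1.2, x.2.2))
  -- The vectorised Pauli string is the unnormalised Bell vector of outcome `t`. Its squared norm
  -- 2^n explains the factor (2^n)⁻¹ in Bob's effect.
  let w : (κ → PauliLabel) → Qubits κ × Qubits κ → ℂ := fun t x => pauliString t x.1 x.2
  refine ⟨D × Qubits κ, U, (κ → PauliLabel) × V, inferInstance, inferInstance, _, inferInstance,
    fun i u => (M i u).submatrix e e,
    fun j x => ((2 : ℂ) ^ n)⁻¹ •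
      (N (j, x.1) x.2 ⊗ₖ Matrix.vecMulVec (w x.1) (star (w x.1))).submatrix g g,
    fun i u j x => r i u (j, x.1) x.2, ⟨k₀ + n, by omega, ?_⟩, hU, ?_,
    fun i => (hM i).submatrix ?_, fun j => ⟨fun x => ?_, ?_⟩, fun i j => ?_⟩
  · simp [hD, pow_add, hn]
  · simp only [Fintype.card_prod, Fintype.card_fun, ZMod.card, pow_add, pow_mul, ← hn]
    exact Nat.mul_le_mul_left _ hV
  · rintro ⟨a, d, q⟩ ⟨a', d', q'⟩ h
    simp only [e, Prod.mk.injEq] at h ⊢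
    tauto
  · refine Matrix.PosSemidef.smul (Matrix.PosSemidef.submatrix ?_ g) (by positivity)
    exact ((hN _).1 _).kronecker (Matrix.posSemidef_vecMulVec_self_star _)
  · ext ⟨⟨b, p⟩, ⟨d, q⟩⟩ ⟨⟨b', p'⟩, ⟨d', q'⟩⟩
    have h1 : ∀ t, ∑ v, N (j, t) v (b, d) (b', d') = (1 : Matrix (B × D) (B × D) ℂ) (b, d) (b', d') := by
      intro t
      rw [← (hN (j, t)).2, Matrix.sum_apply]
    simp only [Matrix.sum_apply, Matrix.smul_apply, Matrix.submatrix_apply, g,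
      Matrix.kroneckerMap_apply, Matrix.vecMulVec_apply, Fintype.sum_prod_type, w, Pi.star_apply,
      smul_eq_mul, ← Finset.mul_sum, ← Finset.sum_mul, h1, sum_pauliString, Matrix.one_apply,
      Prod.mk.injEq, ← hn]
    by_cases h3 : b = b' ∧ d = d' <;> by_cases h4 : p = p' ∧ q = q'
    · simp [h3, h4, h2]
    · simp only [h3, h4, if_false, mul_zero]
      rw [if_neg (by tauto)]
    · simp only [h3, if_false, mul_zero, zero_mul]
      rw [if_neg (by tauto)]
    · simp only [h3, if_false, mul_zero, zero_mul]
      rw [if_neg (by tauto)]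
  · ext ⟨a, b, p⟩ ⟨a', b', p'⟩
    have hcard : (Fintype.card (κ → PauliLabel) : ℂ) = 2 ^ n * 2 ^ n := by
      simp only [Fintype.card_fun, Fintype.card_prod, ZMod.card, ← hn]
      push_cast
      rw [← mul_pow]
      norm_num
    -- By `hO` all 4^n outcomes reproduce the same operator, so `O` is their average. One factor
    -- 2^(-n) comes from the Bell effects, the other from the dimension of the new entangled
    -- systems.
    have h5 : O i j (a, b, p) (a', b', p') = ∑ t : κ → PauliLabel, ((2 : ℂ) ^ n * 2 ^ n)⁻¹ *
        ∑ q, ∑ q', pauliString t p q * O' i (j, t) ((a, q), b) ((a', q'), b') *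
        star (pauliString t p' q') := by
      simp only [← hO, Finset.sum_const, nsmul_eq_mul, Finset.card_univ]
      rw [hcard, ← mul_assoc, mul_inv_cancel₀ (mul_ne_zero h2 h2), one_mul]
    rw [h5]
    simp only [h, Matrix.sum_apply, Matrix.smul_apply, Fintype.sum_prod_type, contract,
      Matrix.of_apply, Matrix.submatrix_apply, e, g, Matrix.kroneckerMap_apply, w,
      Matrix.vecMulVec_apply, Pi.star_apply, smul_eq_mul]
    rw [Finset.sum_comm]
    refine Finset.sum_congr rfl fun t _ => ?_
    let F : Qubits κ × Qubits κ × U × V × D × D → ℂ := fun x =>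
      ((2 : ℂ) ^ n * 2 ^ n)⁻¹ * (pauliString t p x.1 * (signChar (r i x.2.2.1 (j, t) x.2.2.2.1) *
        ((Fintype.card D : ℂ)⁻¹ * (M i x.2.2.1 ((a, x.1), x.2.2.2.2.1) ((a', x.2.1), x.2.2.2.2.2) *
          N (j, t) x.2.2.2.1 (b, x.2.2.2.2.1) (b', x.2.2.2.2.2)))) * star (pauliString t p' x.2.1))
    let σ : U × V × D × Qubits κ × D × Qubits κ ≃ Qubits κ × Qubits κ × U × V × D × D :=
      { toFun := fun y => (y.2.2.2.1, y.2.2.2.2.2, y.1, y.2.1, y.2.2.1, y.2.2.2.2.1)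
        invFun := fun x => (x.2.2.1, x.2.2.2.1, x.2.2.2.2.1, x.1, x.2.2.2.2.2, x.2.1)
        left_inv := fun _ => rfl
        right_inv := fun _ => rfl }
    trans ∑ x, F x
    · simp only [Fintype.sum_prod_type, F, Finset.mul_sum, Finset.sum_mul]
    · rw [← Equiv.sum_comp σ]
      have hc : (Fintype.card (D × Qubits κ) : ℂ)⁻¹ = (Fintype.card D : ℂ)⁻¹ * ((2 : ℂ) ^ n)⁻¹ := by
        rw [Fintype.card_prod, Fintype.card_fun, Fintype.card_fin]
        push_cast
        rw [mul_inv, hn]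
      simp only [Fintype.sum_prod_type, F, σ, Equiv.coe_fn_mk, Finset.mul_sum, hc, mul_inv]
      refine Finset.sum_congr rfl fun u _ => Finset.sum_congr rfl fun v _ => ?_
      refine Finset.sum_congr rfl fun d _ => Finset.sum_congr rfl fun q _ => ?_
      exact Finset.sum_congr rfl fun d' _ => Finset.sum_congr rfl fun q' _ => by ring

end Rules

/-! ### Walks and the bits they compute -/

section Walk

variable {I J I' J' S : Type}

/-- Products of permutations, each of which is known to Alice or to Bob; `n` counts the factors
known to Alice. -/
inductive Walk {I J S : Type} : ℕ → (I → J → Equiv.Perm S) → Prop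
  | refl : Walk 0 fun _ _ => 1
  | bob {n : ℕ} {π : I → J → Equiv.Perm S} (h : Walk n π) (β : J → Equiv.Perm S) :
      Walk n fun i j => β j * π i j
  | alice {n : ℕ} {π : I → J → Equiv.Perm S} (h : Walk n π) (α : I → Equiv.Perm S) :
      Walk (n + 1) fun i j => α i * π i j

lemma Walk.of_bob (β : J → Equiv.Perm S) : Walk (I := I) 0 fun _ j => β j := by
  simpa using Walk.refl.bob β

lemma Walk.of_alice (α : I → Equiv.Perm S) : Walk (J := J) 1 fun i _ => α i := by
  simpa using Walk.refl.alice α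

lemma Walk.mul {m n : ℕ} {π π' : I → J → Equiv.Perm S} (h' : Walk m π') (h : Walk n π) :
    Walk (m + n) fun i j => π' i j * π i j := by
  induction h' with
  | refl => simpa using h
  | bob _ β ih => simpa only [mul_assoc] using ih.bob β
  | alice _ α ih => simpa only [mul_assoc, Nat.add_right_comm] using ih.alice α

lemma Walk.inv {n : ℕ} {π : I → J → Equiv.Perm S} (h : Walk n π) :
    Walk n fun i j => (π i j)⁻¹ := by
  induction h with
  | refl => simpa using Walk.refl
  | bob _ β ih => simpa only [mul_inv_rev, add_zero] using ih.mul (Walk.of_bob fun j => (β j)⁻¹)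
  | alice _ α ih => simpa only [mul_inv_rev] using ih.mul (Walk.of_alice fun i => (α i)⁻¹)

lemma Walk.pullback {n : ℕ} {π : I → J → Equiv.Perm S} (h : Walk n π) (a : I' → I)
    (b : J' → J) : Walk n fun i j => π (a i) (b j) := by
  induction h with
  | refl => exact Walk.refl
  | bob _ β ih => exact ih.bob fun j => β (b j)
  | alice _ α ih => exact ih.alice fun i => α (a i)

/-- Permutations of the first component. -/
def permLift (S X : Type) : Equiv.Perm S →* Equiv.Perm (S × X) where
  toFun π := Equiv.prodCongr π (Equiv.refl X)
  map_one' := rfl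
  map_mul' _ _ := rfl

lemma permLift_apply {X : Type} (π : Equiv.Perm S) (p : S × X) :
    permLift S X π p = (π p.1, p.2) := rfl

lemma Walk.map {T : Type} {n : ℕ} {π : I → J → Equiv.Perm S} (h : Walk n π)
    (f : Equiv.Perm S →* Equiv.Perm T) : Walk n fun i j => f (π i j) := by
  induction h with
  | refl => simpa using Walk.refl
  | bob _ β ih => simpa only [map_mul] using ih.bob fun j => f (β j)
  | alice _ α ih => simpa only [map_mul] using ih.alice fun i => f (α i)

/-- The bit `f i j` is added to a bit by a walk that starts and ends at `w`. -/
def CleanBit {I J : Type} (W : Type) (w : W) (n : ℕ) (f : I → J → ZMod 2) : Prop :=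
  ∃ π : I → J → Equiv.Perm (W × ZMod 2), Walk n π ∧ ∀ i j b, π i j (w, b) = (w, b + f i j)

variable {W : Type} {w : W} {m n : ℕ} {f g : I → J → ZMod 2}

/-- Since the workspace returns to `w`, the two walks can be run one after the other on the same
target bit. -/
lemma CleanBit.add (hf : CleanBit W w m f) (hg : CleanBit W w n g) :
    CleanBit W w (m + n) fun i j => f i j + g i j := by
  obtain ⟨π, hπ, hf⟩ := hf
  obtain ⟨π', hπ', hg⟩ := hg
  refine ⟨_, hπ.mul hπ', fun i j b => ?_⟩
  simp only [Equiv.Perm.mul_apply, hf, hg, add_assoc, add_comm (g i j)]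

lemma CleanBit.pullback (hf : CleanBit W w n f) (a : I' → I) (b : J' → J) :
    CleanBit W w n fun i j => f (a i) (b j) := by
  obtain ⟨π, hπ, hf⟩ := hf
  exact ⟨_, hπ.pullback a b, fun i j => hf _ _⟩

/-- The permutation that adds `g w` to the second component of `(w, b)`. -/
def toggle (g : W → ZMod 2) : Equiv.Perm (W × ZMod 2) :=
  Equiv.prodShear (Equiv.refl W) fun w => Equiv.addRight (g w)

lemma toggle_apply (g : W → ZMod 2) (p : W × ZMod 2) : toggle g p = (p.1, p.2 + g p.1) := rfl

lemma CleanBit.of_alice (w : W) (f : I → ZMod 2) : CleanBit (J := J) W w 1 fun i _ => f i :=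
  ⟨_, Walk.of_alice fun i => toggle fun _ => f i, fun _ _ _ => rfl⟩

/-- A function of the endpoint of a walk is a clean bit. -/
lemma Walk.cleanBit {π : I → J → Equiv.Perm W} (h : Walk n π) (w : W) (g : W → ZMod 2) :
    CleanBit W w (2 * n) fun i j => g (π i j w) := by
  rw [two_mul]
  -- Walk, let Bob add `g` of the endpoint to the target bit, and walk back; only the two walks cost
  -- Alice steps.
  refine ⟨_, (h.inv.map (permLift W (ZMod 2))).mul
    ((h.map (permLift W (ZMod 2))).bob fun _ => toggle g), fun i j b => ?_⟩
  simp only [Equiv.Perm.mul_apply, permLift_apply, toggle_apply, Prod.mk.injEq, and_true]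
  rw [← Equiv.Perm.mul_apply, inv_mul_cancel, Equiv.Perm.one_apply]

/-- The old target bit becomes workspace: compute into it, copy to a new target, uncompute. This
moves old bits to the workspace of the next layer, where they can be added to new ones. -/
lemma CleanBit.lift (hf : CleanBit W w n f) (X : Type) (x : X) :
    CleanBit ((W × ZMod 2) × X) ((w, 0), x) (2 * n) f := by
  obtain ⟨π, hπ, hf⟩ := hf
  simpa only [permLift_apply, hf, zero_add] using
    (hπ.map (permLift _ X)).cleanBit ((w, 0), x) fun p => p.1.2

end Walk

/-! ### Moving a qubit through a register by teleportation -/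

section Register

variable {I J B B' R S : Type} {k cA cB : ℕ}

/-- Bob holds the whole quantum system. -/
def BobImplementable [DecidableEq B] (k cA cB : ℕ) (O : I → J → Matrix B B ℂ) : Prop :=
  Implementable (A := Unit) k cA cB fun i j => (O i j).submatrix Prod.snd Prod.snd

lemma BobImplementable.mono [DecidableEq B] {O : I → J → Matrix B B ℂ} {k' cA' cB' : ℕ}
    (h : BobImplementable k cA cB O) (hk : k ≤ k') (hA : cA ≤ cA') (hB : cB ≤ cB') :
    BobImplementable k' cA' cB' O :=
  Implementable.mono h hk hA hB

lemma BobImplementable.kraus [Fintype B] [DecidableEq B] [Fintype B'] [DecidableEq B'] {H : Type}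
    [Fintype H] {O : I → J → Matrix B' B' ℂ} (h : BobImplementable k cA cB O)
    (K : J → H → Matrix B' B ℂ) (hK : ∀ j, ∑ x, (K j x)ᴴ * K j x = 1) :
    BobImplementable k cA cB fun i j => ∑ x, (K j x)ᴴ * O i j * K j x := by
  have h1 := Implementable.kraus_right h K hK
  unfold BobImplementable
  convert h1 using 3 with i j
  ext ⟨_, b⟩ ⟨_, b'⟩
  simp only [Matrix.submatrix_apply, Matrix.sum_apply]
  refine Finset.sum_congr rfl fun x _ => ?_
  rw [conj_kronecker_apply]
  simp [Matrix.mul_apply, Finset.sum_mul]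

lemma BobImplementable.unitary [Fintype B] [DecidableEq B] {O : I → J → Matrix B B ℂ}
    (h : BobImplementable k cA cB O) (V : Matrix B B ℂ) (hV : Vᴴ * V = 1) :
    BobImplementable k cA cB fun i j => conjBy Vᴴ (O i j) := by
  simpa [conjBy] using h.kraus (fun _ (_ : Unit) => V) fun _ => by simpa using hV

/-- Bob discards the part `g` of a system with parts `f` and `g`. -/
lemma BobImplementable.discard [Fintype B] [DecidableEq B] [Fintype B'] [DecidableEq B']
    {X : Type} [Fintype X] [DecidableEq X] {O : I → J → Matrix B' B' ℂ}
    (h : BobImplementable k cA cB O) (f : B → B') (g : B → X)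
    (hfg : ∀ y y', f y = f y' → g y = g y' → y = y') :
    BobImplementable k cA cB fun i j =>
      Matrix.of fun y y' => if g y = g y' then O i j (f y) (f y') else 0 := by
  let K : X → Matrix B' B ℂ := fun x =>
    Matrix.of fun p y => if g y = x then (if f y = p then 1 else 0) else 0
  have hK : ∀ H : Matrix B' B' ℂ, ∑ x, (K x)ᴴ * H * K x =
      Matrix.of fun y y' => if g y = g y' then H (f y) (f y') else 0 := by
    intro H
    ext y y'
    simp only [K, Matrix.sum_apply, Matrix.mul_apply, Matrix.conjTranspose_apply, Matrix.of_apply,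
      apply_ite star, star_one, star_zero, mul_ite, ite_mul, mul_one, one_mul, mul_zero, zero_mul]
    rw [Finset.sum_eq_single (g y')]
    · simp
    · intro x _ hx
      simp [hx.symm]
    · simp
  have hK1 : ∑ x, (K x)ᴴ * K x = 1 := by
    have h1 := hK 1
    simp only [Matrix.mul_one] at h1
    rw [h1]
    ext y y'
    by_cases hy : y = y'
    · subst hy
      simp
    · by_cases hg : g y = g y'
      · have hf : f y ≠ f y' := fun hf => hy (hfg _ _ hf hg)
        simp [hf, hy]
      · simp [hg, hy]
  simpa only [hK] using h.kraus (fun _ => K) fun _ => hK1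

lemma BobImplementable.submatrix [DecidableEq B] [DecidableEq B'] {O : I → J → Matrix B' B' ℂ}
    (h : BobImplementable k cA cB O) (g : J → B → B') (hg : ∀ j, Function.Injective (g j)) :
    BobImplementable k cA cB fun i j => (O i j).submatrix (g j) (g j) :=
  Implementable.submatrix h (fun _ => id) g (fun _ => Function.injective_id) hg

/-- The operator on `R × Qubits S` that acts on `R` and on the qubit at position `s`. -/
def obs [DecidableEq S] [Fintype S] (s : S) (G : Matrix (R × Fin 2) (R × Fin 2) ℂ) :
    Matrix (R × Qubits S) (R × Qubits S) ℂ :=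
  Matrix.of fun p p' => if ∀ s', s' ≠ s → p.2 s' = p'.2 s' then
    G (p.1, p.2 s) (p'.1, p'.2 s) else 0


lemma conjBy_one_kronecker_apply [Fintype R] [DecidableEq R] {T : Type} [Fintype T] (U : Matrix T T ℂ)
    (X : Matrix (R × T) (R × T) ℂ) (r r' : R) (t t' : T) :
    conjBy ((1 : Matrix R R ℂ) ⊗ₖ U) X (r, t) (r', t') =
      ∑ q, ∑ q', U t q * X (r, q) (r', q') * star (U t' q') := by
  rw [conjBy_apply]
  simp [Fintype.sum_prod_type, Matrix.one_apply, apply_ite (starRingEnd ℂ)]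

lemma obs_apply [Fintype S] [DecidableEq S] (s : S) (G : Matrix (R × Fin 2) (R × Fin 2) ℂ) (r r' : R) (t t' : Qubits S) :
    obs s G (r, t) (r', t') = tensorGate (fun s' => if s' = s then
      Matrix.of fun a a' => G (r, a) (r', a') else 1) t t' := by
  simp only [obs, tensorGate, Matrix.of_apply]
  rw [Fintype.prod_eq_mul_prod_compl s, if_pos rfl, Matrix.of_apply]
  have h1 : ∀ s' ∈ ({s}ᶜ : Finset S), (if s' = s then
      Matrix.of fun a a' => G (r, a) (r', a') else 1) (t s') (t' s') =
        if t s' = t' s' then (1 : ℂ) else 0 := by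
    intro i hi
    rw [if_neg (by simpa using hi), Matrix.one_apply]
  rw [Finset.prod_congr rfl h1, Finset.prod_ite_zero]
  simp

lemma one_kronecker_phaseEq [DecidableEq R] {m n : Type} {A A' : Matrix m n ℂ} (h : PhaseEq A A') :
    PhaseEq ((1 : Matrix R R ℂ) ⊗ₖ A) ((1 : Matrix R R ℂ) ⊗ₖ A') := by
  obtain ⟨c, hc, rfl⟩ := h
  exact ⟨c, hc, by rw [Matrix.kronecker_smul]⟩

variable [Fintype S] [DecidableEq S] [Fintype R] [DecidableEq R]

/-- Away from position `s` the observable is the identity, so the gates there cancel against their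
adjoints. -/
lemma obs_conjBy (s : S) (G : Matrix (R × Fin 2) (R × Fin 2) ℂ)
    (g : S → Matrix (Fin 2) (Fin 2) ℂ) (hg : ∀ s, (g s)ᴴ * g s = 1) :
    conjBy ((1 : Matrix R R ℂ) ⊗ₖ tensorGate g) (obs s G) =
      obs s (conjBy ((1 : Matrix R R ℂ) ⊗ₖ g s) G) := by
  ext ⟨r, t⟩ ⟨r', t'⟩
  rw [conjBy_one_kronecker_apply, obs_apply]
  simp only [obs_apply, conjBy_one_kronecker_apply]
  rw [← conjBy_apply, conjBy, tensorGate_conjTranspose, tensorGate_mul, tensorGate_mul]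
  congr 2
  funext s'
  by_cases h : s' = s
  · subst h
    simp only [if_true]
    ext a a'
    rw [← conjBy, conjBy_apply]
    rfl
  · simp only [if_neg h, Matrix.mul_one]
    exact mul_eq_one_comm.1 (hg s')

/-- The operator on `R × Qubits S` that acts on `R` and on the qubit at a given position, with a
given Pauli error. -/
def errorObs (x : S × PauliLabel) (G : Matrix (R × Fin 2) (R × Fin 2) ℂ) :
    Matrix (R × Qubits S) (R × Qubits S) ℂ :=
  obs x.1 (conjBy ((1 : Matrix R R ℂ) ⊗ₖ pauliOp x.2) G)

lemma conjBy_pauliOp_add (φ ψ : PauliLabel) (G : Matrix (R × Fin 2) (R × Fin 2) ℂ) :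
    conjBy ((1 : Matrix R R ℂ) ⊗ₖ pauliOp φ) (conjBy ((1 : Matrix R R ℂ) ⊗ₖ pauliOp ψ) G) =
      conjBy ((1 : Matrix R R ℂ) ⊗ₖ pauliOp (φ + ψ)) G := by
  rw [← conjBy_mul, ← Matrix.mul_kronecker_mul, Matrix.one_mul]
  exact (one_kronecker_phaseEq (pauliOp_mul φ ψ)).conjBy_eq G

lemma errorObs_pauliString (t : S → PauliLabel) (x : S × PauliLabel)
    (G : Matrix (R × Fin 2) (R × Fin 2) ℂ) :
    conjBy ((1 : Matrix R R ℂ) ⊗ₖ pauliString t) (errorObs x G) =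
      errorObs (x.1, x.2 + t x.1) G := by
  rw [errorObs, pauliString, obs_conjBy _ _ _ fun s => by
    rw [pauliOp_conjTranspose, pauliOp_mul_self], conjBy_pauliOp_add, errorObs, add_comm]

lemma errorObs_perm (α : Equiv.Perm S) (x : S × PauliLabel)
    (G : Matrix (R × Fin 2) (R × Fin 2) ℂ) :
    errorObs x G = (errorObs (α x.1, x.2) G).submatrix
      (fun p => (p.1, p.2 ∘ α.symm)) (fun p => (p.1, p.2 ∘ α.symm)) := by
  ext p p'
  simp only [errorObs, obs, Matrix.of_apply, Matrix.submatrix_apply, Function.comp_apply,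
    Equiv.symm_apply_apply]
  congr 1
  refine propext ⟨fun h s' hs => h _ fun h' => hs ?_, fun h s' hs => ?_⟩
  · rw [← h', Equiv.apply_symm_apply]
  · simpa using h (α s') (by simpa using hs)

/-- Bob teleports a register to Alice, who permutes the qubits and teleports them back. -/
lemma BobImplementable.relay (α : I → Equiv.Perm S) (x : I → J → S × PauliLabel)
    (G : I → J → Matrix (R × Fin 2) (R × Fin 2) ℂ)
    (h : BobImplementable k cA cB fun (i : I × (S → PauliLabel)) (j : J × (S → PauliLabel)) =>
      errorObs (α i.1 (x i.1 j.1).1, (x i.1 j.1).2 + j.2 (x i.1 j.1).1 +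
        i.2 (α i.1 (x i.1 j.1).1)) (G i.1 j.1)) :
    BobImplementable (k + 2 * Fintype.card S) (2 * Fintype.card S + cA)
      (2 * Fintype.card S + cB) fun i j => errorObs (x i j) (G i j) := by
  have hcancel : ∀ (t : S → PauliLabel) (y : S × PauliLabel) (H : Matrix (R × Fin 2) (R × Fin 2) ℂ)
      (r : R) (p : Qubits S) (r' : R) (p' : Qubits S),
      errorObs y H (r, p) (r', p') = ∑ q, ∑ q', pauliString t p q *
        errorObs (y.1, y.2 + t y.1) H (r, q) (r', q') * star (pauliString t p' q') := by
    intro t y H r p r' p'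
    rw [← conjBy_one_kronecker_apply, errorObs_pauliString]
    simp only [add_assoc, show ∀ φ : PauliLabel, φ + φ = 0 by decide, add_zero, Prod.mk.eta]
  have hback := (Implementable.teleport (κ := S) h.swap
    (O := fun (j : J × (S → PauliLabel)) (i : I) =>
      (errorObs (α i (x i j.1).1, (x i j.1).2 + j.2 (x i j.1).1) (G i j.1)).submatrix
        (fun p : R × (Unit × Qubits S) => (p.1, p.2.2)) (fun p => (p.1, p.2.2)))
    fun j i t r _ p r' _ p' => hcancel t _ _ _ _ _ _).swap
  have hperm := hback.submatrix (fun i (p : Unit × Qubits S) => (p.1, p.2 ∘ (α i).symm))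
    (fun _ => id) (fun i p p' hp => by
      simp only [Prod.mk.injEq] at hp
      exact Prod.ext rfl ((α i).symm.surjective.injective_comp_right hp.2))
    (fun _ => Function.injective_id)
  -- Bob's teleportation to Alice precedes her permutation, so his outcome acts at the position
  -- before `α`.
  refine (Implementable.teleport (κ := S) hperm (O := fun i j =>
    (errorObs (x i j) (G i j)).submatrix Prod.snd Prod.snd)
    fun i j t _ r p _ r' p' => ?_).mono (by omega) le_rfl le_rfl
  refine (hcancel t _ _ _ _ _ _).trans ?_
  rw [errorObs_perm (α i)]
  rfl

/-- Walking through a register: the position of a qubit follows `π` while the teleportations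
produce a Pauli error that is itself computed by a walk. -/
lemma Walk.exists_lift {n : ℕ} {π : I → J → Equiv.Perm S} (h : Walk n π) :
    ∃ (I' J' : Type) (a : I' → I) (b : J' → J) (π' : I' → J' → Equiv.Perm (S × PauliLabel)),
      Walk n π' ∧ (∀ i j y, (π' i j y).1 = π (a i) (b j) y.1) ∧
      ∀ {R : Type} [Fintype R] [DecidableEq R] {k cA cB : ℕ} (x : I → J → S × PauliLabel)
        (G : I → J → Matrix (R × Fin 2) (R × Fin 2) ℂ),
        BobImplementable k cA cB (fun i j => errorObs (π' i j (x (a i) (b j))) (G (a i) (b j))) →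
        BobImplementable (k + 2 * Fintype.card S * n) (cA + 2 * Fintype.card S * n)
          (cB + 2 * Fintype.card S * n) fun i j => errorObs (x i j) (G i j) := by
  induction h with
  | refl =>
    exact ⟨I, J, id, id, fun _ _ => 1, Walk.refl, fun _ _ _ => rfl, fun x G h => h⟩
  | @bob n π h β ih =>
    obtain ⟨I', J', a, b, π', hπ', hcov, himp⟩ := ih
    refine ⟨I', J', a, b, _, hπ'.bob fun j => permLift S PauliLabel (β (b j)),
      fun i j y => by simp [permLift_apply, hcov], fun x G h => himp x G ?_⟩
    have h1 := h.submatrix (fun j (p : _ × Qubits S) => (p.1, p.2 ∘ (β (b j)).symm))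
      (fun j p p' hp => by
        simp only [Prod.mk.injEq] at hp
        exact Prod.ext hp.1 ((β (b j)).symm.surjective.injective_comp_right hp.2))
    simpa only [Equiv.Perm.mul_apply, permLift_apply, ← errorObs_perm] using h1
  | @alice n π h α ih =>
    obtain ⟨I', J', a, b, π', hπ', hcov, himp⟩ := ih
    let shift (t : S → PauliLabel) : Equiv.Perm (S × PauliLabel) :=
      Equiv.prodShear (Equiv.refl S) fun s => Equiv.addRight (t s)
    have hshift : ∀ t y, shift t y = (y.1, y.2 + t y.1) := fun _ _ => rfl
    -- Bob's outcome shifts the error at the old position, then Alice moves the qubit and her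
    -- outcome shifts the error at the new position. Her two operations merge into one factor, so
    -- the number of Alice steps stays the same.
    refine ⟨I' × (S → PauliLabel), J' × (S → PauliLabel), fun i => a i.1, fun j => b j.1,
      _, ((hπ'.pullback Prod.fst Prod.fst).bob fun j : J' × (S → PauliLabel) => shift j.2).alice
        fun i : I' × (S → PauliLabel) => shift i.2 * permLift S PauliLabel (α (a i.1)),
      fun i j y => by simp [permLift_apply, hcov, hshift], fun {R} _ _ k cA cB x G h => ?_⟩
    have h1 := BobImplementable.relay (fun i => α (a i)) (fun i j => π' i j (x (a i) (b j)))
      (fun i j => G (a i) (b j)) (by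
        simpa only [Equiv.Perm.mul_apply, permLift_apply, hshift] using h)
    exact (himp x G h1).mono (le_of_eq (by ring)) (le_of_eq (by ring)) (le_of_eq (by ring))

end Register

/-! ### Correcting a controlled phase gate -/

/-- A power of the phase gate. -/
def phasePow (b : ZMod 2) : Matrix (Fin 2) (Fin 2) ℂ := if b = 1 then phaseGate else 1

lemma phasePow_unitary (b : ZMod 2) : (phasePow b)ᴴ * phasePow b = 1 := by
  unfold phasePow
  split_ifs
  · exact phaseGate_unitary
  · simp

lemma phasePow_zero : phasePow 0 = 1 := by simp [phasePow]

/-- The label of a Pauli operator moved past a power of the phase gate. -/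
def shearPerm (b : ZMod 2) : Equiv.Perm PauliLabel where
  toFun φ := (φ.1, φ.2 + b * φ.1)
  invFun φ := (φ.1, φ.2 + b * φ.1)
  left_inv := by revert b; decide
  right_inv := by revert b; decide

lemma pauliOp_mul_phasePow (φ : PauliLabel) (b : ZMod 2) :
    PhaseEq (pauliOp φ * phasePow b) (phasePow b * pauliOp (shearPerm b φ)) := by
  have h : ∀ c : ZMod 2, c = 0 ∨ c = 1 := by decide
  rcases h b with rfl | rfl
  · simpa [phasePow, shearPerm] using PhaseEq.refl _
  · simpa [phasePow, shearPerm, phaseShear] using pauliOp_mul_phaseGate φ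

section Correction

variable {I J : Type} {k cA cB n : ℕ}

/-- The exponent depends on the position alone, so Bob can act on all positions at once without
knowing where the qubit is. Moving the gates past the error shears its label. -/
lemma errorObs_phasePow {R S : Type} [Fintype R] [DecidableEq R] [Fintype S] [DecidableEq S]
    (g : S → ZMod 2) (x : S × PauliLabel) (G : Matrix (R × Fin 2) (R × Fin 2) ℂ) :
    errorObs x (conjBy ((1 : Matrix R R ℂ) ⊗ₖ phasePow (g x.1)) G) =
      conjBy ((1 : Matrix R R ℂ) ⊗ₖ tensorGate fun s => phasePow (g s))
        (errorObs (x.1, shearPerm (g x.1) x.2) G) := by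
  rw [errorObs, errorObs, obs_conjBy _ _ _ fun s => phasePow_unitary _]
  congr 1
  simp only [← conjBy_mul, ← Matrix.mul_kronecker_mul, Matrix.one_mul]
  exact (one_kronecker_phaseEq (pauliOp_mul_phasePow _ _)).conjBy_eq G

lemma one_kronecker_unitary {R S : Type} [Fintype R] [DecidableEq R] [Fintype S] [DecidableEq S]
    {V : Matrix S S ℂ} (hV : Vᴴ * V = 1) :
    ((1 : Matrix R R ℂ) ⊗ₖ V)ᴴ * ((1 : Matrix R R ℂ) ⊗ₖ V) = 1 := by
  rw [Matrix.conjTranspose_kronecker, ← Matrix.mul_kronecker_mul, hV]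
  simp

lemma BobImplementable.of_conjBy {B : Type} [Fintype B] [DecidableEq B]
    {O : I → J → Matrix B B ℂ} (h : BobImplementable k cA cB O) (V : Matrix B B ℂ)
    (hV : Vᴴ * V = 1) : BobImplementable k cA cB fun i j => conjBy V (O i j) := by
  simpa using h.unitary Vᴴ (by rw [Matrix.conjTranspose_conjTranspose]; exact mul_eq_one_comm.1 hV)

/-- A phase gate that is controlled by a clean bit can be traded for a Pauli error whose
components are clean bits. -/
lemma CleanBit.exists_correction {W : Type} [Fintype W] [DecidableEq W] {w : W}
    {f : I → J → ZMod 2} (hf : CleanBit W w n f) :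
    ∃ (I' J' : Type) (a : I' → I) (b : J' → J) (e : I' → J' → PauliLabel),
      (∀ φ, CleanBit ((W × ZMod 2) × PauliLabel) ((w, 0), 0) (4 * n)
        fun i j => pauliComm (e i j) φ) ∧
      ∀ {R : Type} [Fintype R] [DecidableEq R] {k cA cB : ℕ}
        (O : I → J → Matrix (R × Fin 2) (R × Fin 2) ℂ),
        BobImplementable k cA cB (fun i j => conjBy ((1 : Matrix R R ℂ) ⊗ₖ pauliOp (e i j))
          (O (a i) (b j))) →
        BobImplementable (k + 8 * Fintype.card W * n) (cA + 8 * Fintype.card W * n)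
          (cB + 8 * Fintype.card W * n)
          fun i j => conjBy ((1 : Matrix R R ℂ) ⊗ₖ phasePow (f i j)) (O i j) := by
  obtain ⟨π, hπ, hf⟩ := hf
  obtain ⟨I₁, J₁, a₁, b₁, π₁, hπ₁, hcov₁, himp₁⟩ := hπ.exists_lift
  -- The return walk is lifted separately, over data that already include the outcomes of the
  -- forward walk.
  obtain ⟨I₂, J₂, a₂, b₂, π₂, hπ₂, hcov₂, himp₂⟩ := (hπ.pullback a₁ b₁).inv.exists_lift
  let x₀ : (W × ZMod 2) × PauliLabel := ((w, 0), 0)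
  let shear : Equiv.Perm ((W × ZMod 2) × PauliLabel) :=
    Equiv.prodShear (Equiv.refl _) fun s => shearPerm s.2
  have hshear : ∀ y, shear y = (y.1, shearPerm y.1.2 y.2) := fun _ => rfl
  have hpos₁ : ∀ i j, (π₁ i j x₀).1 = (w, f (a₁ i) (b₁ j)) := by
    intro i j
    rw [hcov₁, hf, zero_add]
  -- The final position does not depend on the private data, so Bob knows which qubit to keep and
  -- can discard the others.
  have hpos₂ : ∀ i j, (π₂ i j (shear (π₁ (a₂ i) (b₂ j) x₀))).1 = (w, 0) := by
    intro i j
    rw [hcov₂, hshear, hpos₁, Equiv.Perm.inv_eq_iff_eq, hf, zero_add]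
  refine ⟨I₂, J₂, fun i => a₁ (a₂ i), fun j => b₁ (b₂ j),
    fun i j => (π₂ i j (shear (π₁ (a₂ i) (b₂ j) x₀))).2, fun φ => ?_, fun {R} _ _ k cA cB O h => ?_⟩
  -- The new error is read off the endpoint of a walk with n + n Alice steps; making this bit clean
  -- doubles the number to 4n.
  · have h1 := (hπ₂.mul ((hπ₁.pullback a₂ b₂).bob fun _ => shear)).cleanBit x₀
      fun y => pauliComm y.2 φ
    rw [show 4 * n = 2 * (n + n) by ring]
    exact h1
  · have hdisc : BobImplementable k cA cB fun i j =>
        errorObs (π₂ i j (shear (π₁ (a₂ i) (b₂ j) x₀))) (O (a₁ (a₂ i)) (b₁ (b₂ j))) := by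
      have h1 := h.discard (fun p : R × Qubits (W × ZMod 2) => (p.1, p.2 (w, 0)))
        (fun p (s : {s : W × ZMod 2 // s ≠ (w, 0)}) => p.2 s) (by
          rintro ⟨r, t⟩ ⟨r', t'⟩ h1 h2
          simp only [Prod.mk.injEq] at h1 ⊢
          refine ⟨h1.1, funext fun s => ?_⟩
          by_cases hs : s = (w, 0)
          · rw [hs, h1.2]
          · exact congrFun h2 ⟨s, hs⟩)
      convert h1 using 3 with i j
      ext p p'
      simp only [errorObs, obs, hpos₂, Matrix.of_apply, funext_iff, Subtype.forall]
    have hgate := (himp₂ (fun i j => shear (π₁ i j x₀)) (fun i j => O (a₁ i) (b₁ j)) hdisc).of_conjBy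
      ((1 : Matrix R R ℂ) ⊗ₖ tensorGate fun s : W × ZMod 2 => phasePow s.2)
      (one_kronecker_unitary (tensorGate_unitary fun s => phasePow_unitary _))
    have hwalk := himp₁ (fun _ _ => x₀)
      (fun i j => conjBy ((1 : Matrix R R ℂ) ⊗ₖ phasePow (f i j)) (O i j)) (by
        convert hgate using 3 with i j
        rw [hshear, ← errorObs_phasePow (fun s : W × ZMod 2 => s.2), hpos₁])
    -- Bob puts the data qubit at (w, 0) and fills the other positions with |0⟩.
    have hins := hwalk.submatrix
      (fun _ (p : R × Fin 2) => (p.1, (Function.update (fun _ => 0) (w, 0) p.2 : Qubits _)))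
      (fun _ p p' hp => by
        simp only [Prod.mk.injEq] at hp
        exact Prod.ext hp.1 (by simpa using congrFun hp.2 (w, 0)))
    have hcard : Fintype.card (W × ZMod 2) = Fintype.card W * 2 := by
      rw [Fintype.card_prod, ZMod.card]
    refine BobImplementable.mono (k := k + 2 * Fintype.card (W × ZMod 2) * n +
      2 * Fintype.card (W × ZMod 2) * n) (cA := cA + 2 * Fintype.card (W × ZMod 2) * n +
      2 * Fintype.card (W × ZMod 2) * n) (cB := cB + 2 * Fintype.card (W × ZMod 2) * n +
      2 * Fintype.card (W × ZMod 2) * n) ?_ (le_of_eq (by rw [hcard]; ring))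
      (le_of_eq (by rw [hcard]; ring)) (le_of_eq (by rw [hcard]; ring))
    convert hins using 3 with i j
    ext p p'
    simp only [x₀, errorObs, obs, pauliOp_zero, Matrix.submatrix_apply, Matrix.of_apply,
      Matrix.one_kronecker_one, conjBy_one, Function.update_self]
    rw [if_pos]
    intro s hs
    rw [Function.update_of_ne hs, Function.update_of_ne hs]

end Correction

/-! ### Layer-by-layer simulation of the circuit -/

section Circuit

variable {I J ι : Type} [Fintype ι] [DecidableEq ι] {k cA cB n N : ℕ}

lemma conjBy_submatrix_equiv {m m' : Type} [Fintype m] [Fintype m'] (e : m ≃ m')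
    (A X : Matrix m' m' ℂ) :
    conjBy (A.submatrix e e) (X.submatrix e e) = (conjBy A X).submatrix e e := by
  simp only [conjBy, Matrix.conjTranspose_submatrix, Matrix.submatrix_mul_equiv]

/-- The splitting of a register into the qubits other than `r` and the qubit `r`. -/
def splitQubit (r : ι) : Qubits ι ≃ ({q // q ≠ r} → Fin 2) × Fin 2 :=
  (Equiv.funSplitAt r (Fin 2)).trans (Equiv.prodComm _ _)

lemma tensorGate_mulSingle (r : ι) (A : Matrix (Fin 2) (Fin 2) ℂ) :
    tensorGate (Pi.mulSingle r A) =
      ((1 : Matrix ({q // q ≠ r} → Fin 2) ({q // q ≠ r} → Fin 2) ℂ) ⊗ₖ A).submatrix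
        (splitQubit r) (splitQubit r) := by
  ext s t
  have h1 : ∀ q ∈ ({r}ᶜ : Finset ι), (Pi.mulSingle r A : ι → Matrix (Fin 2) (Fin 2) ℂ) q
      (s q) (t q) = if s q = t q then (1 : ℂ) else 0 := by
    intro q hq
    rw [Pi.mulSingle_eq_of_ne (by simpa using hq), Matrix.one_apply]
  simp only [tensorGate, Matrix.of_apply]
  rw [Fintype.prod_eq_mul_prod_compl r, Finset.prod_congr rfl h1, Finset.prod_ite_zero,
    Pi.mulSingle_eq_same]
  simp [splitQubit, Matrix.one_apply, funext_iff, mul_comm]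

lemma CleanBit.exists_correction_at {W : Type} [Fintype W] [DecidableEq W] {w : W}
    {f : I → J → ZMod 2} (hf : CleanBit W w n f) (r : ι) :
    ∃ (I' J' : Type) (a : I' → I) (b : J' → J) (e : I' → J' → PauliLabel),
      (∀ φ, CleanBit ((W × ZMod 2) × PauliLabel) ((w, 0), 0) (4 * n)
        fun i j => pauliComm (e i j) φ) ∧
      ∀ {k cA cB : ℕ} (O : I → J → Matrix (Qubits ι) (Qubits ι) ℂ),
        BobImplementable k cA cB (fun i j => conjBy (tensorGate (Pi.mulSingle r (pauliOp (e i j))))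
          (O (a i) (b j))) →
        BobImplementable (k + 8 * Fintype.card W * n) (cA + 8 * Fintype.card W * n)
          (cB + 8 * Fintype.card W * n)
          fun i j => conjBy (tensorGate (Pi.mulSingle r (phasePow (f i j)))) (O i j) := by
  obtain ⟨I', J', a, b, e, he, himp⟩ := hf.exists_correction
  refine ⟨I', J', a, b, e, he, fun O h => ?_⟩
  have key : ∀ A (X : Matrix (Qubits ι) (Qubits ι) ℂ), conjBy (tensorGate (Pi.mulSingle r A)) X =
      (conjBy ((1 : Matrix ({q // q ≠ r} → Fin 2) ({q // q ≠ r} → Fin 2) ℂ) ⊗ₖ A)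
        (X.submatrix (splitQubit r).symm (splitQubit r).symm)).submatrix
        (splitQubit r) (splitQubit r) := by
    intro A X
    rw [← conjBy_submatrix_equiv, tensorGate_mulSingle, Matrix.submatrix_submatrix]
    simp
  have h1 := himp (fun i j => (O i j).submatrix (splitQubit r).symm (splitQubit r).symm) (by
    have h2 := h.submatrix (fun _ => (splitQubit r).symm) fun _ => (splitQubit r).symm.injective
    simp only [key, Matrix.submatrix_submatrix, Equiv.self_comp_symm, Matrix.submatrix_id_id] at h2
    exact h2)
  simp only [key]
  exact h1.submatrix (fun _ => splitQubit r) fun _ => (splitQubit r).injective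

/-- Qubits are corrected one at a time. All conditions `f q` refer to errors from before the layer
and share the workspace `W`, so all new errors live on one enlarged workspace and their bits simply
add. Hence the workspace grows per layer, not per gate. -/
lemma exists_corrections {W : Type} [Fintype W] [DecidableEq W] (w : W) (n : ℕ) (Q : Finset ι) :
    ∀ {I J : Type} {N : ℕ} {f : ι → I → J → ZMod 2} {E : I → J → ι → PauliLabel},
      (∀ q, CleanBit W w n (f q)) →
      (∀ τ, CleanBit ((W × ZMod 2) × PauliLabel) ((w, 0), 0) N
        fun i j => stringComm (E i j) τ) →
      ∃ (I' J' : Type) (a : I' → I) (b : J' → J) (E' : I' → J' → ι → PauliLabel),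
        (∀ τ, CleanBit ((W × ZMod 2) × PauliLabel) ((w, 0), 0) (N + 4 * n * Q.card)
          fun i j => stringComm (E' i j) τ) ∧
        ∀ {k cA cB : ℕ} (O : I → J → Matrix (Qubits ι) (Qubits ι) ℂ),
          BobImplementable k cA cB (fun i j => conjBy (pauliString (E' i j)) (O (a i) (b j))) →
          BobImplementable (k + 8 * Fintype.card W * n * Q.card)
            (cA + 8 * Fintype.card W * n * Q.card) (cB + 8 * Fintype.card W * n * Q.card)
            fun i j => conjBy (tensorGate fun q =>
              (if q ∈ Q then phasePow (f q i j) else 1) * pauliOp (E i j q)) (O i j) := by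
  induction Q using Finset.induction_on with
  | empty =>
    intro I J N f E hf hE
    refine ⟨I, J, id, id, E, by simpa using hE, fun O h => ?_⟩
    simpa [pauliString] using h
  | insert r Q hr ih =>
    intro I J N f E hf hE
    obtain ⟨I₁, J₁, a₁, b₁, e, he, himp₁⟩ := (hf r).exists_correction_at r
    obtain ⟨I₂, J₂, a₂, b₂, E', hE', himp₂⟩ := ih (N := N + 4 * n)
      (E := fun i j => E (a₁ i) (b₁ j) + Pi.single r (e i j))
      (fun q => (hf q).pullback a₁ b₁) (fun τ => by
        simpa only [stringComm_add_left, stringComm_single_left] using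
          ((hE τ).pullback a₁ b₁).add (he (τ r)))
    refine ⟨I₂, J₂, fun i => a₁ (a₂ i), fun j => b₁ (b₂ j), E', fun τ => ?_, fun O h => ?_⟩
    · rw [Finset.card_insert_of_notMem hr, show N + 4 * n * (Q.card + 1) =
        N + 4 * n + 4 * n * Q.card by ring]
      exact hE' τ
    · have h1 := himp₂ (fun i j => O (a₁ i) (b₁ j)) h
      have h2 := himp₁ (fun i j => conjBy (tensorGate fun q =>
        (if q ∈ Q then phasePow (f q i j) else 1) * pauliOp (E i j q)) (O i j)) (by
          convert h1 using 3 with i j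
          rw [← conjBy_mul, tensorGate_mul]
          refine PhaseEq.conjBy_eq (PhaseEq.tensorGate fun q => ?_) _
          by_cases hq : q = r
          · subst hq
            simp only [Pi.mulSingle_eq_same, if_neg hr, Matrix.one_mul, Pi.add_apply,
              Pi.single_eq_same]
            rw [add_comm]
            exact pauliOp_mul _ _
          · simp only [Pi.mulSingle_eq_of_ne hq, Matrix.one_mul, Pi.add_apply,
              Pi.single_eq_of_ne hq, add_zero]
            exact PhaseEq.refl _)
      have h3 : (fun i j => conjBy (tensorGate fun q =>
          (if q ∈ insert r Q then phasePow (f q i j) else 1) * pauliOp (E i j q)) (O i j)) =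
          fun i j => conjBy (tensorGate (Pi.mulSingle r (phasePow (f r i j))))
            (conjBy (tensorGate fun q =>
              (if q ∈ Q then phasePow (f q i j) else 1) * pauliOp (E i j q)) (O i j)) := by
        funext i j
        rw [← conjBy_mul, tensorGate_mul]
        congr 2
        funext q
        by_cases hq : q = r
        · subst hq
          simp [hr]
        · simp [hq]
      rw [h3, Finset.card_insert_of_notMem hr]
      exact h2.mono (le_of_eq (by ring)) (le_of_eq (by ring)) (le_of_eq (by ring))

/-- The Pauli errors `E i j` are tracked by walks. -/
def Tracked {I J : Type} (s N : ℕ) (E : I → J → ι → PauliLabel) : Prop :=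
  ∃ (W : Type) (_ : Fintype W) (_ : DecidableEq W) (w : W), 2 * Fintype.card W = s ∧
    ∀ τ, CleanBit W w N fun i j => stringComm (E i j) τ

/-- A layer of `T` gates. -/
lemma Tracked.exists_tLayer {s N : ℕ} {E : I → J → ι → PauliLabel} (hE : Tracked s N E)
    (T : Finset ι) :
    ∃ (I' J' : Type) (a : I' → I) (b : J' → J) (E' : I' → J' → ι → PauliLabel),
      Tracked (8 * s) ((4 * Fintype.card ι + 2) * N) E' ∧
      ∀ {k cA cB : ℕ} (O : I → J → Matrix (Qubits ι) (Qubits ι) ℂ),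
        BobImplementable k cA cB (fun i j => conjBy (pauliString (E' i j)) (O (a i) (b j))) →
        BobImplementable (k + 4 * Fintype.card ι * (s * N)) (cA + 4 * Fintype.card ι * (s * N))
          (cB + 4 * Fintype.card ι * (s * N))
          fun i j => conjBy (pauliString (E i j)) (conjBy (tLayer T)ᴴ (O i j)) := by
  obtain ⟨W, _, _, w, hs, hE⟩ := hE
  -- The X-component of the error on `q` is its commutation bit with Z on `q`; outside `T` the zero
  -- string gives exponent 0. The value 2N is the cost of `CleanBit.lift` for the old error bits.
  obtain ⟨I', J', a, b, E', hE', himp⟩ := exists_corrections w N (Finset.univ : Finset ι)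
    (N := 2 * N) (f := fun q i j => stringComm (E i j) (if q ∈ T then Pi.single q (0, 1) else 0))
    (fun q => hE _) (fun τ => (hE τ).lift PauliLabel 0)
  refine ⟨I', J', a, b, E', ⟨(W × ZMod 2) × PauliLabel, inferInstance, inferInstance, ((w, 0), 0),
    ?_, fun τ => ?_⟩, fun {k cA cB} O h => ?_⟩
  · simp only [Fintype.card_prod, ZMod.card, ← hs]
    ring
  · convert hE' τ using 1
    rw [Finset.card_univ]
    ring
  · have hT : ∀ q, (if q ∈ T then tGate else 1)ᴴ * (if q ∈ T then tGate else 1) = 1 := by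
      intro q
      split_ifs
      · exact tGate_unitary
      · simp
    have hT1 : (tLayer T)ᴴ * tLayer T = 1 := tensorGate_unitary hT
    have h1 := ((himp O h).unitary (tLayer T) hT1).mono
      (k' := k + 4 * Fintype.card ι * (s * N)) (cA' := cA + 4 * Fintype.card ι * (s * N))
      (cB' := cB + 4 * Fintype.card ι * (s * N)) (le_of_eq (by rw [← hs, Finset.card_univ]; ring))
      (le_of_eq (by rw [← hs, Finset.card_univ]; ring))
      (le_of_eq (by rw [← hs, Finset.card_univ]; ring))
    convert h1 using 3 with i j
    rw [← conjBy_mul, ← conjBy_mul]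
    refine PhaseEq.conjBy_eq ?_ _
    rw [tLayer, tensorGate_conjTranspose, tensorGate_mul, pauliString, tensorGate_mul]
    refine PhaseEq.tensorGate fun q => ?_
    by_cases hq : q ∈ T
    · simp only [if_pos hq, Finset.mem_univ, if_true, stringComm_single_right]
      have h2 : phasePow (pauliComm (E i j q) (0, 1)) =
          if (E i j q).1 = 1 then phaseGate else 1 := by
        simp [phasePow, pauliComm]
      have h3 := ((PhaseEq.refl tGateᴴ).mul (tGate_mul_pauliOp (E i j q))).mul
        (PhaseEq.refl tGateᴴ)
      rw [← h2, ← Matrix.mul_assoc, tGate_unitary, Matrix.one_mul, Matrix.mul_assoc,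
        Matrix.mul_assoc, mul_eq_one_comm.1 tGate_unitary, Matrix.mul_one] at h3
      exact h3
    · have h2 : stringComm (E i j) 0 = 0 := by simp [stringComm, pauliComm]
      simp only [if_neg hq, Finset.mem_univ, if_true, h2, phasePow_zero]
      simpa using PhaseEq.refl _

/-- A layer of Clifford gates. -/
lemma Tracked.exists_clifford {s N : ℕ} {E : I → J → ι → PauliLabel} (hE : Tracked s N E)
    {C : Matrix (Qubits ι) (Qubits ι) ℂ} (hC : IsClifford C) :
    ∃ E' : I → J → ι → PauliLabel, Tracked s N E' ∧
      ∀ {k cA cB : ℕ} (O : I → J → Matrix (Qubits ι) (Qubits ι) ℂ),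
        BobImplementable k cA cB (fun i j => conjBy (pauliString (E' i j)) (O i j)) →
        BobImplementable k cA cB
          fun i j => conjBy (pauliString (E i j)) (conjBy Cᴴ (O i j)) := by
  obtain ⟨W, _, _, w, hs, hE⟩ := hE
  obtain ⟨g, hg⟩ := hC.exists_pushforward
  refine ⟨fun i j => g (E i j), ⟨W, inferInstance, inferInstance, w, hs, fun τ => ?_⟩, fun O h => ?_⟩
  -- The bit of CEC† against τ is the bit of E against C†τC, up to phases. This is why `Tracked`
  -- quantifies over all strings τ.
  · obtain ⟨τ', hτ⟩ := hC.exists_pullback τ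
    simpa only [stringComm_congr_phase hC.mul_conjTranspose (hg _) hτ] using hE τ'
  · convert h.unitary C hC.conjTranspose_mul using 3 with i j
    rw [← conjBy_mul, ← conjBy_mul]
    refine PhaseEq.conjBy_eq ?_ _
    have h1 := (hg (E i j)).symm.mul (PhaseEq.refl Cᴴ)
    rwa [Matrix.mul_assoc _ C, hC.mul_conjTranspose, Matrix.mul_one] at h1

/-- A circuit of `T`-depth `d`. -/
lemma HasTDepth.exists_simulation [Nonempty ι] {d : ℕ} {U : Matrix (Qubits ι) (Qubits ι) ℂ}
    (hU : HasTDepth d U) : ∀ {I J : Type} {s N : ℕ} {E : I → J → ι → PauliLabel},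
    Tracked s N E →
    ∃ (I' J' : Type) (a : I' → I) (b : J' → J) (E' : I' → J' → ι → PauliLabel),
      Tracked (8 ^ d * s) ((4 * Fintype.card ι + 2) ^ d * N) E' ∧
      ∀ {k cA cB : ℕ} (O : I → J → Matrix (Qubits ι) (Qubits ι) ℂ),
        BobImplementable k cA cB (fun i j => conjBy (pauliString (E' i j)) (O (a i) (b j))) →
        BobImplementable (k + (68 * Fintype.card ι) ^ d * (s * N))
          (cA + (68 * Fintype.card ι) ^ d * (s * N)) (cB + (68 * Fintype.card ι) ^ d * (s * N))
          fun i j => conjBy (pauliString (E i j)) (conjBy Uᴴ (O i j)) := by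
  induction hU with
  | clifford hC =>
    intro I J s N E hE
    obtain ⟨E', hE', himp⟩ := hE.exists_clifford hC
    exact ⟨I, J, id, id, E', by simpa using hE', fun O h =>
      (himp O h).mono (Nat.le_add_right _ _) (Nat.le_add_right _ _) (Nat.le_add_right _ _)⟩
  | @layer d U C _ T hC ih =>
    intro I J s N E hE
    obtain ⟨I₁, J₁, a₁, b₁, E₁, hE₁, himp₁⟩ := ih hE
    obtain ⟨I₂, J₂, a₂, b₂, E₂, hE₂, himp₂⟩ := hE₁.exists_tLayer T
    obtain ⟨E₃, hE₃, himp₃⟩ := hE₂.exists_clifford hC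
    refine ⟨I₂, J₂, fun i => a₁ (a₂ i), fun j => b₁ (b₂ j), E₃, ?_, fun O h => ?_⟩
    · convert hE₃ using 1 <;> ring
    · have h1 := himp₁ (fun i j => conjBy (tLayer T)ᴴ (conjBy Cᴴ (O i j)))
        (himp₂ (fun i j => conjBy Cᴴ (O (a₁ i) (b₁ j))) (himp₃ _ h))
      -- With c ≥ 1 qubits, a layer multiplies s·N by 8(4c+2) ≤ 48c ≤ 68c, and the cost of all
      -- layers so far fits because 4c+1 ≤ 68c.
      have hbound : 4 * Fintype.card ι * (8 ^ d * s * ((4 * Fintype.card ι + 2) ^ d * N)) +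
          (68 * Fintype.card ι) ^ d * (s * N) ≤ (68 * Fintype.card ι) ^ (d + 1) * (s * N) := by
        have hn : 1 ≤ Fintype.card ι := Fintype.card_pos
        have h2 : (8 * (4 * Fintype.card ι + 2)) ^ d ≤ (68 * Fintype.card ι) ^ d :=
          Nat.pow_le_pow_left (by omega) d
        calc 4 * Fintype.card ι * (8 ^ d * s * ((4 * Fintype.card ι + 2) ^ d * N)) +
            (68 * Fintype.card ι) ^ d * (s * N) =
            (4 * Fintype.card ι * (8 * (4 * Fintype.card ι + 2)) ^ d +
              (68 * Fintype.card ι) ^ d) * (s * N) := by rw [mul_pow 8]; ring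
          _ ≤ (4 * Fintype.card ι * (68 * Fintype.card ι) ^ d +
              (68 * Fintype.card ι) ^ d) * (s * N) := by gcongr
          _ = ((4 * Fintype.card ι + 1) * (68 * Fintype.card ι) ^ d) * (s * N) := by ring
          _ ≤ (68 * Fintype.card ι * (68 * Fintype.card ι) ^ d) * (s * N) := by
            gcongr
            omega
          _ = _ := by ring
      have h2 : (fun i j => conjBy (pauliString (E i j))
          (conjBy (C * tLayer T * U)ᴴ (O i j))) = fun i j => conjBy (pauliString (E i j))
          (conjBy Uᴴ (conjBy (tLayer T)ᴴ (conjBy Cᴴ (O i j)))) := by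
        funext i j
        simp only [← conjBy_mul, Matrix.conjTranspose_mul, Matrix.mul_assoc]
      rw [h2]
      exact h1.mono (by rw [add_assoc]; gcongr) (by rw [add_assoc]; gcongr)
        (by rw [add_assoc]; gcongr)

end Circuit

/-! ### Measuring Pauli strings -/

section Pauli

variable {I J ι : Type} [Fintype ι]

/-- The projective measurement of a Pauli string. -/
def pauliEffect (τ : ι → PauliLabel) (v : ZMod 2) : Matrix (Qubits ι) (Qubits ι) ℂ :=
  (1 / 2 : ℂ) • (1 + signChar v • pauliString τ)

lemma sum_zmod_two {M : Type} [AddCommMonoid M] (f : ZMod 2 → M) : ∑ v, f v = f 0 + f 1 :=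
  Fin.sum_univ_two f

lemma signChar_mul_self (v : ZMod 2) : signChar v * signChar v = 1 := by
  unfold signChar; split_ifs <;> simp

lemma star_signChar (v : ZMod 2) : star (signChar v) = signChar v := by
  unfold signChar; split_ifs <;> simp

lemma sum_signChar_pauliEffect (τ : ι → PauliLabel) :
    ∑ v, signChar v • pauliEffect τ v = pauliString τ := by
  rw [sum_zmod_two]
  simp only [pauliEffect, signChar_zero, signChar_one]
  module

variable [DecidableEq ι]

lemma isPOVM_pauliEffect (τ : ι → PauliLabel) : IsPOVM (pauliEffect τ) := by
  refine ⟨fun v => ?_, ?_⟩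
  · have h1 : (pauliEffect τ v)ᴴ = pauliEffect τ v := by
      simp only [pauliEffect, Matrix.conjTranspose_smul, Matrix.conjTranspose_add,
        Matrix.conjTranspose_one, pauliString_conjTranspose, star_signChar]
      simp
    have h2 : (pauliEffect τ v)ᴴ * pauliEffect τ v = pauliEffect τ v := by
      rw [h1]
      simp only [pauliEffect, Matrix.smul_mul, Matrix.mul_smul, Matrix.add_mul, Matrix.mul_add,
        Matrix.one_mul, Matrix.mul_one, pauliString_mul_self, smul_smul, smul_add]
      match_scalars
      · linear_combination (1 / 4 : ℂ) * signChar_mul_self v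
      · ring
    rw [← h2]
    exact Matrix.posSemidef_conjTranspose_mul_self _
  · rw [sum_zmod_two]
    simp only [pauliEffect, signChar_zero, signChar_one]
    module

lemma BobImplementable.pauliString (τ : ι → PauliLabel) (c : I → J → ZMod 2) :
    BobImplementable 0 0 1 fun i j => signChar (c i j) • pauliString τ := by
  -- Alice's measurement is trivial. The sign is left to the referee's rule, which has access to
  -- both indices.
  have h := Implementable.of_measurements (I := I) (J := J) (A := Unit) (U := Unit) (V := ZMod 2)
    (cA := 0) (cB := 1) (by simp) (by simp [ZMod.card]) (M := fun _ _ => 1)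
    (N := fun _ => pauliEffect τ) (fun _ => ⟨fun _ => Matrix.PosSemidef.one, by simp⟩)
    (fun _ => isPOVM_pauliEffect τ) fun i _ j v => c i j + v
  unfold BobImplementable
  convert h using 3 with i j
  rw [← sum_signChar_pauliEffect]
  ext p p'
  simp [signChar_add, Matrix.sum_apply, Finset.mul_sum, mul_assoc]

lemma pauliString_sum {α β : Type} [Fintype α] [Fintype β] (τ : α ⊕ β → PauliLabel) :
    (pauliString τ).submatrix (fun p : Qubits α × Qubits β => (Sum.elim p.1 p.2 : Qubits _))
      (fun p => (Sum.elim p.1 p.2 : Qubits _)) =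
      pauliString (fun q => τ (.inl q)) ⊗ₖ pauliString (fun q => τ (.inr q)) := by
  ext p p'
  simp [_root_.pauliString, tensorGate, Fintype.prod_sum_type]

end Pauli

/-! ### Encoding outcomes as bit strings -/

section Bits

lemma exists_equiv_bits {U : Type} [Fintype U] {c : ℕ} (h : Fintype.card U ≤ 2 ^ c) :
    ∃ X : Type, ∃ _ : Fintype X, Nonempty (U ⊕ X ≃ (Fin c → Fin 2)) := by
  refine ⟨Fin (2 ^ c - Fintype.card U), inferInstance, ⟨Fintype.equivOfCardEq ?_⟩⟩
  simp only [Fintype.card_sum, Fintype.card_fin, Fintype.card_fun]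
  omega

lemma IsPOVM.extend {E U X V : Type} [DecidableEq E] [Fintype U] [Fintype X] [Fintype V]
    {M : U → Matrix E E ℂ} (h : IsPOVM M) (e : U ⊕ X ≃ V) :
    IsPOVM fun v => Sum.elim M (fun _ => 0) (e.symm v) := by
  refine ⟨fun v => ?_, ?_⟩
  · have h1 : ∀ y, (Sum.elim M (fun _ : X => 0) y).PosSemidef := by
      rintro (u | x)
      · exact h.1 u
      · exact Matrix.PosSemidef.zero
    exact h1 _
  · rw [Equiv.sum_comp e.symm fun y => Sum.elim M (fun _ => 0) y]
    simp [Fintype.sum_sum_type, h.2]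

lemma contract_zero_left {A B D : Type} [Fintype D] (N : Matrix (B × D) (B × D) ℂ) :
    contract (0 : Matrix (A × D) (A × D) ℂ) N = 0 := by
  ext p p'; simp [contract]

lemma contract_zero_right {A B D : Type} [Fintype D] (M : Matrix (A × D) (A × D) ℂ) :
    contract M (0 : Matrix (B × D) (B × D) ℂ) = 0 := by
  ext p p'; simp [contract]

lemma contract_submatrix_equiv {A B D D' : Type} [Fintype D] [Fintype D'] (e : D' ≃ D)
    (M : Matrix (A × D) (A × D) ℂ) (N : Matrix (B × D) (B × D) ℂ) :
    contract (M.submatrix (Prod.map id e) (Prod.map id e))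
      (N.submatrix (Prod.map id e) (Prod.map id e)) = contract M N := by
  ext p p'
  simp only [contract, Matrix.of_apply, Matrix.submatrix_apply, Prod.map_apply, id,
    Fintype.card_congr e]
  congr 1
  rw [← Equiv.sum_comp e]
  refine Finset.sum_congr rfl fun d _ => ?_
  rw [← Equiv.sum_comp e]

lemma contract_one {A B D : Type} [DecidableEq A] [DecidableEq B] [Fintype D] [DecidableEq D]
    [Nonempty D] : contract (1 : Matrix (A × D) (A × D) ℂ) (1 : Matrix (B × D) (B × D) ℂ) = 1 := by
  ext ⟨a, b⟩ ⟨a', b'⟩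
  simp only [contract, Matrix.of_apply, Matrix.one_apply, Prod.mk.injEq]
  by_cases ha : a = a' <;> by_cases hb : b = b' <;> simp [ha, hb]

/-- An implementable observable is measured with shared EPR pairs and messages of bits. -/
lemma Implementable.exists_bits {A B : Type} [DecidableEq A] [DecidableEq B] {k cA cB : ℕ}
    {O : Matrix (A × B) (A × B) ℂ}
    (h : Implementable k cA cB fun (_ : Unit) (_ : Unit) => O) :
    ∃ k₀ ≤ k, ∃ (M : (Fin cA → Fin 2) → Matrix (A × Qubits (Fin k₀)) (A × Qubits (Fin k₀)) ℂ)
      (N : (Fin cB → Fin 2) → Matrix (B × Qubits (Fin k₀)) (B × Qubits (Fin k₀)) ℂ)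
      (r : (Fin cA → Fin 2) → (Fin cB → Fin 2) → ZMod 2), IsPOVM M ∧ IsPOVM N ∧
      O = ∑ u, ∑ v, signChar (r u v) • contract (M u) (N v) := by
  obtain ⟨D, U, V, _, _, _, _, M, N, r, ⟨k₀, hk₀, hD⟩, hU, hV, hM, hN, h⟩ := h
  obtain ⟨X, _, ⟨eU⟩⟩ := exists_equiv_bits hU
  obtain ⟨Y, _, ⟨eV⟩⟩ := exists_equiv_bits hV
  have e : Qubits (Fin k₀) ≃ D := Fintype.equivOfCardEq (by simp [hD])
  have he : ∀ A : Type, Function.Injective (Prod.map id e : A × Qubits (Fin k₀) → A × D) :=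
    fun A => Function.injective_id.prodMap e.injective
  -- The padding outcomes have zero effects, so the value 0 there is arbitrary.
  let r' : U ⊕ X → V ⊕ Y → ZMod 2 := Sum.elim
    (fun u => Sum.elim (fun v => r () u () v) fun _ => 0) fun _ _ => 0
  refine ⟨k₀, hk₀, _, _, fun u v => r' (eU.symm u) (eV.symm v),
    ((hM ()).submatrix (he A)).extend eU, ((hN ()).submatrix (he B)).extend eV, ?_⟩
  refine (h () ()).trans ?_
  symm
  rw [Equiv.sum_comp eU.symm fun y => ∑ v, signChar (r' y (eV.symm v)) • contract
    (Sum.elim (fun u => (M () u).submatrix (Prod.map id e) (Prod.map id e)) (fun _ => 0) y)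
    (Sum.elim (fun v => (N () v).submatrix (Prod.map id e) (Prod.map id e)) (fun _ => 0)
      (eV.symm v)), Fintype.sum_sum_type]
  simp only [Sum.elim_inl, Sum.elim_inr, contract_zero_left, smul_zero, Finset.sum_const_zero,
    add_zero]
  refine Finset.sum_congr rfl fun u _ => ?_
  rw [Equiv.sum_comp eV.symm fun y => signChar (r' (.inl u) y) • contract
    ((M () u).submatrix (Prod.map id e) (Prod.map id e))
    (Sum.elim (fun v => (N () v).submatrix (Prod.map id e) (Prod.map id e)) (fun _ => 0) y),
    Fintype.sum_sum_type]
  simp only [Sum.elim_inl, Sum.elim_inr, contract_zero_right, smul_zero, Finset.sum_const_zero,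
    add_zero, contract_submatrix_equiv, r']

end Bits

/-! ### Born rule for shared states, channels and ancillas -/

section Trace

variable {EA EB FA FB : Type} [Fintype EA] [Fintype EB] [Fintype FA] [Fintype FB]

lemma isDensityMatrix_eprPairs (k : ℕ) : IsDensityMatrix (eprPairs k) := by
  let w : Qubits (Fin k) × Qubits (Fin k) → ℂ := fun s => if s.1 = s.2 then 1 else 0
  have h : eprPairs k = (1 / 2 : ℂ) ^ k • Matrix.vecMulVec w (star w) := by
    ext s t
    simp only [eprPairs, w, Matrix.of_apply, Matrix.smul_apply, Matrix.vecMulVec_apply,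
      Pi.star_apply, smul_eq_mul]
    by_cases h1 : s.1 = s.2 <;> by_cases h2 : t.1 = t.2 <;> simp [h1, h2]
  refine ⟨?_, ?_⟩
  · rw [h]
    refine (Matrix.posSemidef_vecMulVec_self_star w).smul (pow_nonneg ?_ k)
    rw [one_div]
    exact inv_nonneg.2 zero_le_two
  · simp [Matrix.trace, eprPairs, Fintype.sum_prod_type]

lemma IsDensityMatrix.sharedTensor {GA GB : Type} [Fintype GA] [Fintype GB]
    {ρ : Matrix (EA × EB) (EA × EB) ℂ} {τ : Matrix (GA × GB) (GA × GB) ℂ}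
    (hρ : IsDensityMatrix ρ) (hτ : IsDensityMatrix τ) :
    IsDensityMatrix (sharedTensor ρ τ) := by
  let g : (EA × GA) × (EB × GB) ≃ (EA × EB) × (GA × GB) := Equiv.prodProdProdComm _ _ _ _
  have h : _root_.sharedTensor ρ τ = (ρ ⊗ₖ τ).submatrix g g := rfl
  refine ⟨h ▸ (hρ.1.kronecker hτ.1).submatrix g, ?_⟩
  have h1 : (_root_.sharedTensor ρ τ).trace = ρ.trace * τ.trace :=
    (Equiv.sum_comp g fun p => (ρ ⊗ₖ τ) p p).trans (Matrix.trace_kronecker ρ τ)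
  rw [h1, hρ.2, hτ.2, one_mul]

/-- Summing out the EPR pairs in the Born rule leaves exactly `contract`, whose normalisation is
2^(-k) here. -/
lemma trace_mul_sharedTensor_eprPairs {k : ℕ} (ρ : Matrix (EA × EB) (EA × EB) ℂ)
    (M : Matrix (EA × Qubits (Fin k)) (EA × Qubits (Fin k)) ℂ)
    (N : Matrix (EB × Qubits (Fin k)) (EB × Qubits (Fin k)) ℂ) :
    Matrix.trace ((M ⊗ₖ N) * sharedTensor ρ (eprPairs k)) = Matrix.trace (contract M N * ρ) := by
  let F : EA × EB × EA × EB × Qubits (Fin k) × Qubits (Fin k) → ℂ := fun x =>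
    (1 / 2 : ℂ) ^ k * (M (x.1, x.2.2.2.2.1) (x.2.2.1, x.2.2.2.2.2) *
      N (x.2.1, x.2.2.2.2.1) (x.2.2.2.1, x.2.2.2.2.2) * ρ (x.2.2.1, x.2.2.2.1) (x.1, x.2.1))
  let σ : EA × Qubits (Fin k) × EB × EA × Qubits (Fin k) × EB ≃
      EA × EB × EA × EB × Qubits (Fin k) × Qubits (Fin k) :=
    { toFun := fun y => (y.1, y.2.2.1, y.2.2.2.1, y.2.2.2.2.2, y.2.1, y.2.2.2.2.1)
      invFun := fun x => (x.1, x.2.2.2.2.1, x.2.1, x.2.2.1, x.2.2.2.2.2, x.2.2.2.1)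
      left_inv := fun _ => rfl
      right_inv := fun _ => rfl }
  trans ∑ x, F x
  · rw [← Equiv.sum_comp σ]
    simp only [Matrix.trace, Matrix.diag_apply, Matrix.mul_apply, Fintype.sum_prod_type, F, σ,
      sharedTensor, eprPairs, Matrix.of_apply, Matrix.kroneckerMap_apply, Equiv.coe_fn_mk,
      ite_and, mul_ite, mul_zero, Finset.sum_ite_eq, Finset.mem_univ, if_true]
    refine Finset.sum_congr rfl fun a _ => Finset.sum_congr rfl fun d _ => ?_
    refine Finset.sum_congr rfl fun b _ => ?_
    rw [Finset.sum_eq_single d]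
    · simp only [if_true]
      iterate 3 refine Finset.sum_congr rfl fun _ _ => ?_
      ring
    · intro d' _ hd
      simp [hd.symm]
    · simp
  · have hc : (Fintype.card (Qubits (Fin k)) : ℂ)⁻¹ = (1 / 2 : ℂ) ^ k := by simp
    simp only [Matrix.trace, Matrix.diag_apply, Matrix.mul_apply, Fintype.sum_prod_type, F,
      contract, Matrix.of_apply, Finset.mul_sum, Finset.sum_mul, hc]
    iterate 6 refine Finset.sum_congr rfl fun _ _ => ?_
    ring

lemma trace_kraus_localChannels [DecidableEq EA] [DecidableEq EB] (Φ : QChannel EA FA) (Ψ : QChannel EB FB)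
    (ρ : Matrix (EA × EB) (EA × EB) ℂ) (X : Matrix (FA × FB) (FA × FB) ℂ) :
    Matrix.trace ((∑ i, ∑ j, (Φ.kraus i ⊗ₖ Ψ.kraus j)ᴴ * X * (Φ.kraus i ⊗ₖ Ψ.kraus j)) * ρ) =
      Matrix.trace (X * localChannels Φ Ψ ρ) := by
  simp only [localChannels, Matrix.sum_mul, Matrix.mul_sum, Matrix.trace_sum]
  refine Finset.sum_congr rfl fun i _ => Finset.sum_congr rfl fun j _ => ?_
  rw [Matrix.mul_assoc, Matrix.mul_assoc, Matrix.trace_mul_comm, Matrix.mul_assoc,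
    Matrix.mul_assoc]

/-- Ancillas in |0⟩ only see the block of `X` in which they are 0. -/
lemma trace_mul_withAncillas {mA mB a : ℕ}
    (σ : Matrix (Qubits (Fin mA) × Qubits (Fin mB)) (Qubits (Fin mA) × Qubits (Fin mB)) ℂ)
    (X : Matrix (Qubits (Fin mA ⊕ Fin mB ⊕ Fin a)) (Qubits (Fin mA ⊕ Fin mB ⊕ Fin a)) ℂ) :
    Matrix.trace (X * withAncillas a σ) =
      Matrix.trace (X.submatrix (fun p => (Sum.elim p.1 (Sum.elim p.2 0) : Qubits _))
        (fun p => (Sum.elim p.1 (Sum.elim p.2 0) : Qubits _)) * σ) := by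
  have hsum : ∀ f : Qubits (Fin mA ⊕ Fin mB ⊕ Fin a) → ℂ,
      ∑ s, f s = ∑ p : Qubits (Fin mA), ∑ q : Qubits (Fin mB), ∑ c : Qubits (Fin a),
        f (Sum.elim p (Sum.elim q c)) := by
    intro f
    let e : Qubits (Fin mA) × Qubits (Fin mB) × Qubits (Fin a) ≃
        Qubits (Fin mA ⊕ Fin mB ⊕ Fin a) :=
      ((Equiv.sumArrowEquivProdArrow _ _ _).trans
        (Equiv.prodCongr (Equiv.refl _) (Equiv.sumArrowEquivProdArrow _ _ _))).symm
    rw [← Equiv.sum_comp e, Fintype.sum_prod_type]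
    simp only [Fintype.sum_prod_type]
    rfl
  have hw : ∀ (p p' : Qubits (Fin mA)) (q q' : Qubits (Fin mB)) (c c' : Qubits (Fin a)),
      withAncillas a σ (Sum.elim p (Sum.elim q c)) (Sum.elim p' (Sum.elim q' c')) =
        if c = 0 then (if c' = 0 then σ (p, q) (p', q') else 0) else 0 := by
    intro p p' q q' c c'
    rw [← ite_and]
    exact if_congr (and_congr funext_iff.symm funext_iff.symm) rfl rfl
  simp only [Matrix.trace, Matrix.diag_apply, Matrix.mul_apply, hsum, hw, Fintype.sum_prod_type,
    Matrix.submatrix_apply, mul_ite, mul_zero, Finset.sum_ite_eq', Finset.mem_univ, if_true]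
  simp

end Trace

/-! ### The referee's observable as a two-party observable -/

section Referee

variable {α β : Type} [Fintype α] [DecidableEq α] [Fintype β] [DecidableEq β]

/-- Pauli strings square to 1, so conjugating twice on `α` changes nothing. This is the form that
`Implementable.teleport` needs for Alice's message. -/
lemma pauliString_elim_zero (t : α → PauliLabel)
    (X : Matrix (Qubits (α ⊕ β)) (Qubits (α ⊕ β)) ℂ) (s s' : Qubits β) (p p' : Qubits α) :
    X (Sum.elim p s) (Sum.elim p' s') = ∑ q, ∑ q', pauliString t p q *
      conjBy (pauliString (Sum.elim t 0)) X (Sum.elim q s) (Sum.elim q' s') *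
        star (pauliString t p' q') := by
  let e : Qubits β × Qubits α ≃ Qubits (α ⊕ β) :=
    (Equiv.prodComm _ _).trans (Equiv.sumArrowEquivProdArrow α β (Fin 2)).symm
  have he : ∀ r : Qubits β × Qubits α, e r = Sum.elim r.2 r.1 := fun _ => rfl
  have h1 : (pauliString (Sum.elim t (0 : β → PauliLabel))).submatrix e e =
      (1 : Matrix (Qubits β) (Qubits β) ℂ) ⊗ₖ pauliString t := by
    have h2 := pauliString_sum (Sum.elim t (0 : β → PauliLabel))
    ext x y
    have h3 := congrFun (congrFun h2 x.swap) y.swap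
    refine h3.trans ?_
    simp only [Matrix.kroneckerMap_apply, Sum.elim_inl, Sum.elim_inr, Prod.fst_swap, Prod.snd_swap]
    rw [mul_comm, show (fun q : β => (0 : β → PauliLabel) q) = 0 from rfl, pauliString_zero]
  have h2 : (conjBy (pauliString (Sum.elim t 0)) X).submatrix e e =
      conjBy ((1 : Matrix (Qubits β) (Qubits β) ℂ) ⊗ₖ pauliString t) (X.submatrix e e) := by
    rw [← h1, conjBy_submatrix_equiv]
  have h3 : conjBy ((1 : Matrix (Qubits β) (Qubits β) ℂ) ⊗ₖ pauliString t)
      ((conjBy (pauliString (Sum.elim t 0)) X).submatrix e e) = X.submatrix e e := by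
    rw [h2, ← conjBy_mul, ← Matrix.mul_kronecker_mul, pauliString_mul_self, Matrix.one_mul,
      Matrix.one_kronecker_one, conjBy_one]
  have h4 := congrFun (congrFun h3 (s, p)) (s', p')
  rw [conjBy_one_kronecker_apply] at h4
  exact h4.symm

/-- The observable that is measured after a Clifford circuit is a product of local observables. -/
lemma IsClifford.implementable {C : Matrix (Qubits (α ⊕ β)) (Qubits (α ⊕ β)) ℂ}
    (hC : IsClifford C) (τ : α ⊕ β → PauliLabel) :
    Implementable 0 1 1 fun (_ : Unit) (_ : Unit) => (conjBy Cᴴ (pauliString τ)).submatrix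
      (fun p : Qubits α × Qubits β => (Sum.elim p.1 p.2 : Qubits _))
      (fun p => (Sum.elim p.1 p.2 : Qubits _)) := by
  obtain ⟨b, τ', h⟩ := hC.exists_sign τ
  have h1 := Implementable.of_measurements (I := Unit) (J := Unit) (cA := 1) (cB := 1)
    (U := ZMod 2) (V := ZMod 2) (by simp [ZMod.card]) (by simp [ZMod.card])
    (fun _ => isPOVM_pauliEffect fun q => τ' (.inl q))
    (fun _ => isPOVM_pauliEffect fun q => τ' (.inr q)) fun _ u _ v => b + (u + v)
  convert h1 using 3
  rw [conjBy, Matrix.conjTranspose_conjTranspose, h, Matrix.submatrix_smul, Pi.smul_apply,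
    Pi.smul_apply, pauliString_sum, ← sum_signChar_pauliEffect, ← sum_signChar_pauliEffect]
  ext x y
  simp only [Matrix.smul_apply, Matrix.kroneckerMap_apply, Matrix.sum_apply, smul_eq_mul,
    signChar_add]
  rw [Finset.sum_mul_sum, Finset.mul_sum]
  simp only [Finset.mul_sum]
  refine Finset.sum_congr rfl fun u _ => Finset.sum_congr rfl fun v _ => ?_
  ring

/-- The observable that is measured after a circuit of `T`-depth `d`. -/
lemma HasTDepth.implementable [Nonempty (α ⊕ β)] {d : ℕ}
    {U : Matrix (Qubits (α ⊕ β)) (Qubits (α ⊕ β)) ℂ} (hU : HasTDepth d U)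
    (τ : α ⊕ β → PauliLabel) :
    Implementable (Fintype.card α + (68 * Fintype.card (α ⊕ β)) ^ d * 2)
      (2 * Fintype.card α + (68 * Fintype.card (α ⊕ β)) ^ d * 2)
      (1 + (68 * Fintype.card (α ⊕ β)) ^ d * 2)
      fun (_ : Unit) (_ : Unit) => (conjBy Uᴴ (pauliString τ)).submatrix
        (fun p : Qubits α × Qubits β => (Sum.elim p.1 p.2 : Qubits _))
        (fun p => (Sum.elim p.1 p.2 : Qubits _)) := by
  -- The initial error is Alice's teleportation outcome on `α` and trivial on `β`. Alice knows all
  -- its bits, so a one-point workspace and one Alice step suffice: s = 2, N = 1.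
  have hE : Tracked 2 1 fun (i : Unit × (α → PauliLabel)) (_ : Unit) =>
      (Sum.elim i.2 0 : α ⊕ β → PauliLabel) :=
    ⟨Unit, inferInstance, inferInstance, (), by simp, fun τ => CleanBit.of_alice () _⟩
  obtain ⟨I', J', a, b, E', -, himp⟩ := hU.exists_simulation hE
  have hfin : BobImplementable 0 0 1 fun i j =>
      conjBy (_root_.pauliString (E' i j)) (_root_.pauliString τ) := by
    convert BobImplementable.pauliString τ (fun i j => stringComm (E' i j) τ) using 3 with i j
    rw [conjBy, pauliString_commute, pauliString_conjTranspose, Matrix.smul_mul, Matrix.mul_assoc,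
      pauliString_mul_self, Matrix.mul_one]
  have hbob := himp (fun _ _ => _root_.pauliString τ) hfin
  have halice := (Implementable.swap hbob).submatrix
    (fun _ (p : Qubits β × Qubits α) => (Sum.elim p.2 p.1 : Qubits (α ⊕ β))) (fun _ => id)
    (fun _ p p' h => Prod.ext (funext fun q => by simpa using congrFun h (.inr q))
      (funext fun q => by simpa using congrFun h (.inl q))) (fun _ => Function.injective_id)
  have htel := (Implementable.teleport (κ := α) halice (O := fun (_ : Unit) (_ : Unit) =>
    (conjBy Uᴴ (_root_.pauliString τ)).submatrix
      (fun p : Qubits β × (Unit × Qubits α) => (Sum.elim p.2.2 p.1 : Qubits _))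
      (fun p => (Sum.elim p.2.2 p.1 : Qubits _)))
    fun _ _ t s _ p s' _ p' => pauliString_elim_zero t (conjBy Uᴴ (_root_.pauliString τ)) s s' p p').swap
  exact (htel.submatrix (fun _ (p : Qubits α) => ((), p)) (fun _ => id)
    (fun _ _ _ h => (Prod.ext_iff.1 h).2) (fun _ => Function.injective_id)).mono
      (le_of_eq (by ring)) (le_of_eq (by ring)) (le_of_eq (by ring))

/-- At depth 0 two bits and no EPR pairs suffice. At positive depth the terms linear in the number c
of qubits, which come from teleporting Alice's message, are absorbed by 68c ≤ (68c)^d. -/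
lemma HasTDepth.exists_implementable [Nonempty (α ⊕ β)] {d : ℕ}
    {U : Matrix (Qubits (α ⊕ β)) (Qubits (α ⊕ β)) ℂ} (hU : HasTDepth d U)
    (τ : α ⊕ β → PauliLabel) :
    ∃ k cA cB : ℕ, k ≤ 7 * (68 * Fintype.card (α ⊕ β)) ^ d ∧
      cA + cB ≤ 7 * (68 * Fintype.card (α ⊕ β)) ^ d ∧
      Implementable k cA cB fun (_ : Unit) (_ : Unit) => (conjBy Uᴴ (pauliString τ)).submatrix
        (fun p : Qubits α × Qubits β => (Sum.elim p.1 p.2 : Qubits _))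
        (fun p => (Sum.elim p.1 p.2 : Qubits _)) := by
  cases d with
  | zero =>
    cases hU with
    | clifford hC => exact ⟨0, 1, 1, by simp, by simp, hC.implementable τ⟩
  | succ d =>
    refine ⟨_, _, _, ?_, ?_, hU.implementable τ⟩
    all_goals
      have hn : 1 ≤ Fintype.card (α ⊕ β) := Fintype.card_pos
      have h1 : 68 * Fintype.card (α ⊕ β) ≤ (68 * Fintype.card (α ⊕ β)) ^ (d + 1) :=
        Nat.le_self_pow (Nat.succ_ne_zero d) _
      have h2 : Fintype.card α ≤ Fintype.card (α ⊕ β) := by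
        rw [Fintype.card_sum]
        exact Nat.le_add_right _ _
      omega

end Referee

/-! ### Output probabilities and conclusion -/

lemma ite_eq_signChar (r b : ZMod 2) (z : ℂ) :
    (if r = b then z.re else 0) = ((1 / 2 : ℂ) * (z + signChar b * (signChar r * z))).re := by
  have h : ∀ c : ZMod 2, c = 0 ∨ c = 1 := by decide
  rcases h r with rfl | rfl <;> rcases h b with rfl | rfl <;>
    simp [signChar_zero, signChar_one] <;> ring

/-- The projector onto outcome `b` is (1 + (-1)^b Z)/2, so beyond the trace only the expectation of
the conjugated Z enters. -/
lemma QuantumSMP.outProb_eq {X Y EA EB : Type} [Fintype EA] [DecidableEq EA] [Fintype EB]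
    [DecidableEq EB] {mA mB a : ℕ} (Q : QuantumSMP X Y EA EB mA mB a) (x : X) (y : Y) (b : Fin 2) :
    Q.outProb x y b = ((1 / 2 : ℂ) *
      (Matrix.trace (localChannels (Q.alice x) (Q.bob y) Q.state) +
        signChar (b : ZMod 2) * Matrix.trace
          ((conjBy Q.unitaryᴴ (pauliString (Pi.single Q.outQubit (0, 1)))).submatrix
            (fun p => (Sum.elim p.1 (Sum.elim p.2 0) : Qubits _))
            (fun p => (Sum.elim p.1 (Sum.elim p.2 0) : Qubits _)) *
            localChannels (Q.alice x) (Q.bob y) Q.state))).re := by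
  have hU : Q.unitaryᴴ * Q.unitary = 1 := Matrix.mem_unitaryGroup_iff'.1 Q.isUnitary
  have hinj : Function.Injective
      (fun p : Qubits (Fin mA) × Qubits (Fin mB) =>
        (Sum.elim p.1 (Sum.elim p.2 0) : Qubits (Fin mA ⊕ Fin mB ⊕ Fin a))) :=
    fun p p' h => Prod.ext (funext fun q => by simpa using congrFun h (.inl q))
      (funext fun q => by simpa using congrFun h (.inr (.inl q)))
  have h1 : ∀ P ω : Matrix (Qubits (Fin mA ⊕ Fin mB ⊕ Fin a)) (Qubits (Fin mA ⊕ Fin mB ⊕ Fin a)) ℂ,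
      Matrix.trace (P * (Q.unitary * ω * Q.unitaryᴴ)) =
        Matrix.trace (conjBy Q.unitaryᴴ P * ω) := by
    intro P ω
    rw [conjBy, Matrix.conjTranspose_conjTranspose, Matrix.mul_assoc Q.unitary, ← Matrix.mul_assoc,
      ← Matrix.mul_assoc, Matrix.trace_mul_comm, ← Matrix.mul_assoc, ← Matrix.mul_assoc]
  have h2 : conjBy Q.unitaryᴴ (qubitProjector Q.outQubit b) = (1 / 2 : ℂ) • (1 +
      signChar (b : ZMod 2) • conjBy Q.unitaryᴴ (pauliString (Pi.single Q.outQubit (0, 1)))) := by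
    rw [qubitProjector_eq]
    simp only [conjBy, Matrix.conjTranspose_conjTranspose, Matrix.mul_smul, Matrix.smul_mul,
      Matrix.mul_add, Matrix.add_mul, Matrix.mul_one, hU]
  rw [QuantumSMP.outProb, h1, trace_mul_withAncillas, h2]
  refine congrArg Complex.re ?_
  rw [Matrix.submatrix_smul, Pi.smul_apply, Pi.smul_apply, Matrix.submatrix_add, Pi.add_apply,
    Pi.add_apply, Matrix.submatrix_smul, Pi.smul_apply, Pi.smul_apply,
    Matrix.submatrix_one _ hinj, Matrix.smul_mul, Matrix.trace_smul, Matrix.add_mul,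
    Matrix.trace_add, Matrix.one_mul, Matrix.smul_mul, Matrix.trace_smul, smul_eq_mul, smul_eq_mul]

theorem mainTheorem11 :
    ∃ K : ℕ, ∀ (X Y EA EB : Type) [Fintype EA] [DecidableEq EA] [Fintype EB] [DecidableEq EB]
      (f : X → Y → Option (Fin 2)) (p : ℝ) (mA mB a' m a d : ℕ)
      (Q : QuantumSMP X Y EA EB mA mB a'),
      mA + mB = m → a' ≤ a → HasTDepth d Q.unitary → ComputesWith Q.outProb f p →
      ∃ (k cA cB : ℕ)
        (R : ClassicalSMP X Y (EA × Qubits (Fin k)) (EB × Qubits (Fin k)) cA cB),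
        R.state = sharedTensor Q.state (eprPairs k) ∧
        k ≤ K * (68 * (m + a)) ^ d ∧
        cA + cB ≤ K * (68 * (m + a)) ^ d ∧
        ComputesWith R.outProb f p ∧
        ∀ x y b, R.outProb x y b = Q.outProb x y b := by
  refine ⟨7, fun X Y EA EB _ _ _ _ f p mA mB a' m a d Q hm ha hU hf => ?_⟩
  have : Nonempty (Fin mA ⊕ Fin mB ⊕ Fin a') := ⟨Q.outQubit⟩
  obtain ⟨k, cA, cB, hk, hc, himp⟩ := hU.exists_implementable (Pi.single Q.outQubit (0, 1))
  have hcard : (68 * Fintype.card (Fin mA ⊕ Fin mB ⊕ Fin a')) ^ d ≤ (68 * (m + a)) ^ d := by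
    refine Nat.pow_le_pow_left ?_ d
    simp only [Fintype.card_sum, Fintype.card_fin]
    omega
  -- Bob supplies the ancillas himself, appending |0⟩ to his message.
  have himp' := himp.submatrix (fun _ => id)
    (fun _ (s : Qubits (Fin mB)) => (Sum.elim s 0 : Qubits (Fin mB ⊕ Fin a')))
    (fun _ => Function.injective_id)
    (fun _ s s' h => funext fun q => by simpa using congrFun h (.inl q))
  obtain ⟨k₀, hk₀, M, N, r, hM, hN, hO⟩ := himp'.exists_bits
  -- The channels enter only here, pulled back into the measurements. `M` and `N` are independent of
  -- the inputs, so one referee rule serves all of them.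
  have hA := fun x => hM.kraus (sum_kronecker_one (D := Qubits (Fin k₀)) (Q.alice x).complete)
  have hB := fun y => hN.kraus (sum_kronecker_one (D := Qubits (Fin k₀)) (Q.bob y).complete)
  let R : ClassicalSMP X Y (EA × Qubits (Fin k₀)) (EB × Qubits (Fin k₀)) cA cB :=
    { state := sharedTensor Q.state (eprPairs k₀)
      isDensityMatrix := Q.isDensityMatrix.sharedTensor (isDensityMatrix_eprPairs k₀)
      alice := fun x => ⟨_, (hA x).1, (hA x).2⟩
      bob := fun y => ⟨_, (hB y).1, (hB y).2⟩
      referee := r }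
  have hR : ∀ x y (b : ZMod 2), R.outProb x y b = Q.outProb x y b := by
    intro x y b
    refine Eq.trans ?_ (Q.outProb_eq x y b).symm
    have hT : ∀ u v, Matrix.trace ((((R.alice x).effect u) ⊗ₖ ((R.bob y).effect v)) * R.state) =
        Matrix.trace (contract (M u) (N v) *
          localChannels (Q.alice x) (Q.bob y) Q.state) := by
      intro u v
      have hcontract : contract ((R.alice x).effect u) ((R.bob y).effect v) =
          ∑ i, ∑ j, ((Q.alice x).kraus i ⊗ₖ (Q.bob y).kraus j)ᴴ * contract (M u) (N v) *
            ((Q.alice x).kraus i ⊗ₖ (Q.bob y).kraus j) := by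
        trans contract
          (∑ i, ((Q.alice x).kraus i ⊗ₖ (1 : Matrix (Qubits (Fin k₀)) (Qubits (Fin k₀)) ℂ))ᴴ * M u *
            ((Q.alice x).kraus i ⊗ₖ (1 : Matrix (Qubits (Fin k₀)) (Qubits (Fin k₀)) ℂ)))
          (∑ j, ((Q.bob y).kraus j ⊗ₖ (1 : Matrix (Qubits (Fin k₀)) (Qubits (Fin k₀)) ℂ))ᴴ * N v *
            ((Q.bob y).kraus j ⊗ₖ (1 : Matrix (Qubits (Fin k₀)) (Qubits (Fin k₀)) ℂ)))
        · rfl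
        · simp only [contract_sum_left, contract_sum_right, contract_conj]
          exact Finset.sum_comm
      rw [← trace_kraus_localChannels, ← hcontract]
      exact trace_mul_sharedTensor_eprPairs _ _ _
    -- Completeness of the two measurements accounts for the trace term of `QuantumSMP.outProb_eq`;
    -- `hO` accounts for the Z term.
    have hone : ∑ u, ∑ v, contract (M u) (N v) = 1 := by
      rw [← contract_one (D := Qubits (Fin k₀)), ← hM.2, ← hN.2, contract_sum_left]
      exact Finset.sum_congr rfl fun u _ => (contract_sum_right _ _ _).symm
    have hsum : R.outProb x y b = ∑ u, ∑ v, if r u v = b then (Matrix.trace (contract (M u) (N v) *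
          localChannels (Q.alice x) (Q.bob y) Q.state)).re else 0 := by
      simp only [ClassicalSMP.outProb, hT]
      rfl
    have hind : R.outProb x y b = ∑ u, ∑ v, ((1 / 2 : ℂ) * (Matrix.trace (contract (M u) (N v) *
          localChannels (Q.alice x) (Q.bob y) Q.state) + signChar b *
          (signChar (r u v) * Matrix.trace (contract (M u) (N v) *
          localChannels (Q.alice x) (Q.bob y) Q.state)))).re :=
      hsum.trans (Finset.sum_congr rfl fun u _ => Finset.sum_congr rfl fun v _ =>
        ite_eq_signChar _ _ _)
    have htr₁ : Matrix.trace (localChannels (Q.alice x) (Q.bob y) Q.state) =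
        ∑ u, ∑ v, Matrix.trace (contract (M u) (N v) *
          localChannels (Q.alice x) (Q.bob y) Q.state) := by
      simp only [← Matrix.trace_sum, ← Matrix.sum_mul, hone, Matrix.one_mul]
    have htr₂ : Matrix.trace
        ((conjBy Q.unitaryᴴ (pauliString (Pi.single Q.outQubit (0, 1)))).submatrix
          (fun p => (Sum.elim p.1 (Sum.elim p.2 0) : Qubits _))
          (fun p => (Sum.elim p.1 (Sum.elim p.2 0) : Qubits _)) *
          localChannels (Q.alice x) (Q.bob y) Q.state) =
        ∑ u, ∑ v, signChar (r u v) * Matrix.trace (contract (M u) (N v) *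
          localChannels (Q.alice x) (Q.bob y) Q.state) := by
      refine (congrArg (fun Z => Matrix.trace
        (Z * localChannels (Q.alice x) (Q.bob y) Q.state)) hO).trans ?_
      simp only [Matrix.trace_sum, Matrix.sum_mul, Matrix.smul_mul, Matrix.trace_smul, smul_eq_mul]
    refine hind.trans ?_
    rw [htr₁, htr₂]
    simp only [Finset.mul_sum, ← Finset.sum_add_distrib, Complex.re_sum]
  exact ⟨k₀, cA, cB, R, rfl, hk₀.trans (hk.trans (Nat.mul_le_mul_left _ hcard)),
    hc.trans (Nat.mul_le_mul_left _ hcard), fun x y b h => (hR x y b).symm ▸ hf x y b h,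
    fun x y b => hR x y b⟩

end
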